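/- A category $\mathcal E$ is \emph{countably lextensive} if it has finite limits and countable coproducts, and every countable coproduct in $\mathcal E$ is a van Kampen colimit (i.e. is universal and effective). Let $\mathcal E$ be a countably lextensive category (not assumed to be locally cartesian closed), and let $s\mathcal E = [\Delta^{\mathrm{op}}, \mathcal E]$ be its category of simplicial objects. For $E \in \mathcal E$ and $X \in s\mathcal E$ put $(E \times X)_n = E \times X_n$, and for $X, Y \in s\mathcal E$ let $\underline{\mathrm{Hom}}(X,Y)$ be the presheaf $E \mapsto \mathrm{Hom}_{s\mathcal E}(E \times X, Y)$ on $\mathcal E$. A map $i \colon A \to B$ has the \emph{enriched left lifting property} with respect to $p \colon X \to Y$ (and $p$ has the \emph{enriched right lifting property} with respect to $i$) if the induced map of presheaves $$\underline{\mathrm{Hom}}(B,X) \longrightarrow \underline{\mathrm{Hom}}(A,X) \times_{\underline{\mathrm{Hom}}(A,Y)} \underline{\mathrm{Hom}}(B,Y)$$ is a split epimorphism. For a levelwise countable simplicial set $K$ let $\underline{K} \in s\mathcal E$ be given by $\underline{K}_n = \coprod_{K_n} 1$. A map of $s\mathcal E$ is a \emph{trivial fibration} if it has the enriched right lifting property with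 respect to $\underline{\partial\Delta[n]} \to \underline{\Delta[n]}$ for all $n \geq 0$, and a \emph{cofibration} if it has the enriched left lifting property with respect to all trivial fibrations. An object $X$ of $s\mathcal E$ is \emph{cofibrant} if $\varnothing \to X$ is a cofibration. \textbf{Theorem.} Let $i \colon A \to B$ be a cofibration between cofibrant objects of $s\mathcal E$. Then: \begin{enumerate} \item[(i)] $i$ is exponentiable, i.e. the pullback functor $i^* \colon s\mathcal E \downarrow B \to s\mathcal E \downarrow A$ has a right adjoint $i_*$ (the pushforward along $i$); \item[(ii)] $i_*$ sends cofibrant objects to cofibrant objects: if $X \to A$ is an object of $s\mathcal E \downarrow A$ with $X$ cofibrant in $s\mathcal E$, then the domain of $i_*(X \to A)$ is cofibrant in $s\mathcal E$. \end{enumerate} -/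

import Mathlib

open CategoryTheory CategoryTheory.Limits Opposite
open scoped Simplicial

universe w w' v u

/-- A category is countably lextensive if it has finite limits and countable coproducts, and every
countable coproduct is a van Kampen colimit (i.e. universal and effective). -/
class CountablyLextensive (E : Type u) [Category.{v} E] : Prop where
  hasFiniteLimits : HasFiniteLimits E
  hasCountableCoproducts : HasCountableCoproducts E
  vanKampen : ∀ {J : Type} [Countable J] (F : Discrete J ⥤ E) (c : Cocone F),
    IsColimit c → IsVanKampenColimit c

attribute [instance] CountablyLextensive.hasFiniteLimits
attribute [instance] CountablyLextensive.hasCountableCoproducts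

namespace EnrichedLifting

noncomputable section

section Diagram

variable {E : Type u} [Category.{v} E] [HasFiniteLimits E] {D : Type w} [Category.{w'} D]

/-- The tensor `e × X` of a diagram `X : D ⥤ E` with an object `e` of `E`:
`(e × X)_d = e × X_d`. -/
def tensor (e : E) (X : D ⥤ E) : D ⥤ E :=
  X ⋙ prod.functor.obj e

/-- Functoriality of `e × X` in `X`. -/
def tensorMapRight (e : E) {X X' : D ⥤ E} (f : X ⟶ X') : tensor e X ⟶ tensor e X' :=
  Functor.whiskerRight f (prod.functor.obj e)

/-- Functoriality of `e × X` in `e`. -/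
def tensorMapLeft {e e' : E} (t : e ⟶ e') (X : D ⥤ E) : tensor e X ⟶ tensor e' X :=
  Functor.whiskerLeft X (prod.functor.map t)

lemma tensorMapLeft_id (e : E) (X : D ⥤ E) : tensorMapLeft (𝟙 e) X = 𝟙 (tensor e X) := by
  ext d
  simp [tensorMapLeft, tensor]

lemma tensorMapLeft_comp {e e' e'' : E} (t : e ⟶ e') (t' : e' ⟶ e'') (X : D ⥤ E) :
    tensorMapLeft (t ≫ t') X = tensorMapLeft t X ≫ tensorMapLeft t' X := by
  ext d
  simp [tensorMapLeft, tensor]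

lemma tensorMap_comm {e e' : E} (t : e ⟶ e') {X X' : D ⥤ E} (f : X ⟶ X') :
    tensorMapLeft t X ≫ tensorMapRight e' f = tensorMapRight e f ≫ tensorMapLeft t X' := by
  ext d
  exact ((prod.functor.map t).naturality (f.app d)).symm

/-- The hom-presheaf of the enrichment of `D ⥤ E` in presheaves over `E`: it sends `e` to the set
of maps `e × X ⟶ Y`. -/
def homPresheaf (X Y : D ⥤ E) : Eᵒᵖ ⥤ Type (max w v) where
  obj e := tensor e.unop X ⟶ Y
  map t := ↾fun h => tensorMapLeft t.unop X ≫ h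
  map_id e := by
    refine ConcreteCategory.hom_ext _ _ fun h => ?_
    simp [tensorMapLeft_id]
  map_comp t t' := by
    refine ConcreteCategory.hom_ext _ _ fun h => ?_
    simp [tensorMapLeft_comp]

/-- The presheaf of lifting problems of `i : A ⟶ B` against `p : X ⟶ Y`, i.e. the pullback
`Hom(A, X) ×_{Hom(A, Y)} Hom(B, Y)` of hom-presheaves, computed objectwise. -/
def probPresheaf {A B X Y : D ⥤ E} (i : A ⟶ B) (p : X ⟶ Y) : Eᵒᵖ ⥤ Type (max w v) where
  obj e := { ab : (tensor e.unop A ⟶ X) × (tensor e.unop B ⟶ Y) //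
    ab.1 ≫ p = tensorMapRight e.unop i ≫ ab.2 }
  map t := ↾fun ab => ⟨(tensorMapLeft t.unop A ≫ ab.1.1, tensorMapLeft t.unop B ≫ ab.1.2), by
    rw [Category.assoc, ab.2, ← Category.assoc, tensorMap_comm, Category.assoc]⟩
  map_id e := by
    refine ConcreteCategory.hom_ext _ _ fun h => ?_
    simp [tensorMapLeft_id]
  map_comp t t' := by
    refine ConcreteCategory.hom_ext _ _ fun h => ?_
    simp [tensorMapLeft_comp]

/-- The pullback hom `Hom(B, X) ⟶ Prob(i, p)` of `i : A ⟶ B` and `p : X ⟶ Y`. -/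
def pullbackHom {A B X Y : D ⥤ E} (i : A ⟶ B) (p : X ⟶ Y) :
    homPresheaf B X ⟶ probPresheaf i p where
  app e := ↾fun h => ⟨(tensorMapRight e.unop i ≫ h, h ≫ p), Category.assoc _ _ _⟩
  naturality e e' t := by
    refine ConcreteCategory.hom_ext _ _ fun h => ?_
    refine Subtype.ext (Prod.ext ?_ ?_)
    · have key : ∀ g : tensor e.unop B ⟶ X,
          tensorMapRight e'.unop i ≫ tensorMapLeft t.unop B ≫ g =
            tensorMapLeft t.unop A ≫ tensorMapRight e.unop i ≫ g := fun g => by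
        rw [← Category.assoc, ← tensorMap_comm, Category.assoc]
      exact key h
    · exact Category.assoc _ _ _

/-- `i` has the enriched left lifting property with respect to `p` (equivalently, `p` has the
enriched right lifting property with respect to `i`): the pullback hom is a split epimorphism of
presheaves over `E`. -/
def HasEnrichedLift {A B X Y : D ⥤ E} (i : A ⟶ B) (p : X ⟶ Y) : Prop :=
  IsSplitEpi (pullbackHom i p)

/-- The enriched `I`-fibrations: maps with the enriched right lifting property with respect to
all maps in `I`. -/
def enrichedFibrations (I : MorphismProperty (D ⥤ E)) : MorphismProperty (D ⥤ E) :=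
  fun _ _ p => ∀ ⦃A B : D ⥤ E⦄ (i : A ⟶ B), I i → HasEnrichedLift i p

/-- The enriched `I`-cofibrations: maps with the enriched left lifting property with respect to
all enriched `I`-fibrations. -/
def enrichedCofibrations (I : MorphismProperty (D ⥤ E)) : MorphismProperty (D ⥤ E) :=
  fun _ _ i => ∀ ⦃X Y : D ⥤ E⦄ (p : X ⟶ Y), enrichedFibrations I p → HasEnrichedLift i p

end Diagram

section Simplicial

variable {E : Type u} [Category.{v} E]

instance (n : ℕ) (m : SimplexCategoryᵒᵖ) : Countable ((Δ[n] : SSet.{0}).obj m) :=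
  (SSet.stdSimplex.objEquiv (n := ⦋n⦌) (m := m)).injective.countable

instance (n : ℕ) (m : SimplexCategoryᵒᵖ) : Countable ((∂Δ[n] : SSet.{0}).obj m) :=
  inferInstanceAs (Countable (∂Δ[n].obj m))

variable [HasFiniteLimits E] [HasCountableCoproducts E]

variable (E) in
/-- The levelwise application of `S ↦ S · 1 = ∐_{s ∈ S} 1` to a levelwise countable
simplicial set. -/
def fset (K : SSet.{0}) [∀ m, Countable (K.obj m)] : SimplicialObject E where
  obj m := ∐ fun _ : K.obj m => ⊤_ E
  map {m _} f := Sigma.desc fun s : K.obj m => Sigma.ι (fun _ => ⊤_ E) (K.map f s)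
  map_id m := by
    apply Sigma.hom_ext
    simp
  map_comp f g := by
    apply Sigma.hom_ext
    simp

variable (E) in
/-- Functoriality of `fset`. -/
def fsetMap {K L : SSet.{0}} [∀ m, Countable (K.obj m)] [∀ m, Countable (L.obj m)] (k : K ⟶ L) :
    fset E K ⟶ fset E L where
  app m := Sigma.desc fun s : K.obj m => Sigma.ι (fun _ => ⊤_ E) (k.app m s)
  naturality m m' f := by
    apply Sigma.hom_ext
    intro s
    simp [fset]

variable (E) in
/-- The generating cofibrations of simplicial objects in `E`: the images under `fset` of the
boundary inclusions `∂Δ[n] ⟶ Δ[n]` for `n ≥ 0`. -/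
def boundaryInclusions : MorphismProperty (SimplicialObject E) :=
  MorphismProperty.ofHoms fun n : ℕ => fsetMap E (∂Δ[n] : (Δ[n] : SSet.{0}).Subcomplex).ι

/-- A map of simplicial objects is a cofibration if it is an enriched cofibration with respect to
the boundary inclusions. -/
def Cofibration {A B : SimplicialObject E} (i : A ⟶ B) : Prop :=
  enrichedCofibrations (boundaryInclusions E) i

instance : HasInitial (SimplicialObject E) :=
  inferInstanceAs (HasInitial (SimplexCategoryᵒᵖ ⥤ E))

/-- A simplicial object is cofibrant if the map from the initial object is a cofibration. -/
def Cofibrant (X : SimplicialObject E) : Prop :=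
  Cofibration (initial.to X)

/-- Simplicial objects have pullbacks. -/
instance : HasPullbacks (SimplicialObject E) :=
  inferInstanceAs (HasPullbacks (SimplexCategoryᵒᵖ ⥤ E))

end Simplicial

/-- A map `f : X ⟶ Y` is exponentiable if the pullback functor `f^* : C/Y ⥤ C/X` has a right
adjoint. -/
def Exponentiable {C : Type u} [Category.{v} C] [HasPullbacks C] {X Y : C} (f : X ⟶ Y) : Prop :=
  (Over.pullback f).IsLeftAdjoint

end

end EnrichedLifting

namespace EnrichedLifting

/-! ### Covers and decidable sieves for the extensive topology. -/

section Topology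

variable {E : Type u} [Category.{v} E]

/-! The argument works with generalized elements `T ⟶ X_n`, glued along finite coproduct
decompositions: these are the covers of the extensive topology, for which representables are
sheaves. A condition on elements, i.e. a sieve, is decidable when locally it either holds or fails;
definitions by cases are then legitimate, as in classical mathematics.

Consequences of cofibrancy. Given a split epimorphism `Z ⟶ B_n`, there is a simplicial object over
`B` classifying lifts of `n`-simplices to `Z`. It is a trivial fibration, because lifts along `∂Δ[N]
⟶ Δ[N]` can be chosen one simplex at a time. Lifting a cofibration `A ⟶ B` against it with `Z = A_n
⨿ B_n` shows that `A_n ⟶ B_n` is a coproduct inclusion (`Cofibration.exists_complement`). A variant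
with a constraint along a degeneracy shows that the degeneracies of a cofibrant object are coproduct
inclusions (`Cofibrant.exists_complement`).

A sufficient condition for cofibrancy. If degenerate simplices are decidable, lifts against a
trivial fibration are built by induction on dimension: forced on degenerate simplices, and given by
a natural filler on the others (`cofibrant_of_decides`). The result is unique subject to these
rules, hence natural in the parameter. Degenerate means fixed by a nontrivial idempotent of `[m]`,
so it suffices to decide fixedness under idempotents.

Existence of the pushforward. An `n`-simplex of `i_* X` is a simplex `b` of `B` with a natural
family of simplices of `X` over those faces of `b` that lie in `A` (`PushFamily`). Faces of
dimension at most `n` suffice, and there are finitely many. For a single face, the data are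
classified by `X_m ⨿ C_m`, with `C_m` the complement of `A_m` in `B_m`. Compatibility is an equation
required only where a face lies in `A`; decidability turns it into an unconditional equation, so the
families are represented by a finite limit (`exists_representing_pushFamily`).

Cofibrancy of the pushforward. A family is fixed by an idempotent `e` if and only if its base is,
and its value on every low-dimensional `e`-stable face is fixed by the induced idempotent
(`PushFamily.face_eq_self_iff`). This is a finite conjunction, decidable because `B` and `X` are
cofibrant and membership in `A` is decidable. -/

instance [CountablyLextensive E] : FinitaryExtensive E where
  hasFiniteCoproducts := inferInstance
  hasPullbacksOfInclusions := inferInstance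
  van_kampen' _ hc := CountablyLextensive.vanKampen _ _ hc

variable [FinitaryExtensive E]

/-- A morphism out of `V` may be constructed locally, from unique local solutions of a problem which
is stable under restriction. -/
lemma existsUnique_of_cover {V W : E} {S : Sieve V} (hS : S ∈ extensiveTopology E V)
    (R : ∀ ⦃T : E⦄, (T ⟶ V) → (T ⟶ W) → Prop)
    (hR : ∀ ⦃T T' : E⦄ (u : T' ⟶ T) (t : T ⟶ V) (w : T ⟶ W), R t w → R (u ≫ t) (u ≫ w))
    (hex : ∀ ⦃T : E⦄ (t : T ⟶ V), S t → ∃! w : T ⟶ W, R t w) :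
    ∃! w : V ⟶ W, ∀ ⦃T : E⦄ (t : T ⟶ V), S t → R t (t ≫ w) := by
  have hsh := extensiveTopology.isSheaf_yoneda_obj W S hS
  choose f hf hfu using hex
  let x : Presieve.FamilyOfElements (yoneda.obj W) S.arrows := fun T t ht => f t ht
  -- Uniqueness of the local solutions makes them a matching family.
  have hx : x.Compatible := by
    rw [Presieve.compatible_iff_sieveCompatible]
    intro T T' t u ht
    exact (hfu (u ≫ t) (S.downward_closed ht u) (u ≫ f t ht) (hR u t _ (hf t ht))).symm
  obtain ⟨w, hw, hwu⟩ := hsh x hx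
  refine ⟨w, fun T t ht => ?_, fun w' hw' => hwu w' fun T t ht => ?_⟩
  · have : t ≫ w = f t ht := hw t ht
    rw [this]
    exact hf t ht
  · exact hfu t ht _ (hw' t ht)

lemma hom_ext_of_cover {V W : E} {S : Sieve V} (hS : S ∈ extensiveTopology E V) {f g : V ⟶ W}
    (h : ∀ ⦃T : E⦄ (t : T ⟶ V), S t → t ≫ f = t ≫ g) : f = g := by
  obtain ⟨w, -, hw⟩ := existsUnique_of_cover hS (W := W) (fun T t w => w = t ≫ f)
    (fun _ _ u t w hw => by simp [hw]) (fun T t _ => ⟨t ≫ f, rfl, fun _ h => h⟩)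
  rw [hw f (fun _ _ _ => rfl), hw g (fun _ t ht => (h t ht).symm)]

/-- Used to discharge contradictory cases: an element satisfying both a condition and its negation
has a parameter object covered by the empty sieve, where all equations hold. -/
lemma hom_ext_of_bot {T W : E} (h : ⊥ ∈ extensiveTopology E T) (f g : T ⟶ W) : f = g :=
  hom_ext_of_cover h fun _ _ ht => ht.elim

lemma bot_mem_of_hom {T T' : E} (h : ⊥ ∈ extensiveTopology E T) (u : T' ⟶ T) :
    ⊥ ∈ extensiveTopology E T' := by
  refine GrothendieckTopology.superset_covering _ ?_ ((extensiveTopology E).pullback_stable u h)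
  exact fun _ _ h => h

/-- The negation of a sieve: the morphisms whose restriction lies in the sieve only over objects
covered by the empty sieve. -/
def negSieve {V : E} (S : Sieve V) : Sieve V where
  arrows T t := ∀ ⦃T' : E⦄ (u : T' ⟶ T), S (u ≫ t) → ⊥ ∈ extensiveTopology E T'
  downward_closed h u _ u' hu := h (u' ≫ u) (by simpa using hu)

/-- A sieve is decidable if, locally, every morphism lies in it or in its negation. -/
def Decides {V : E} (S : Sieve V) : Prop :=
  S ⊔ negSieve S ∈ extensiveTopology E V

lemma bot_mem_of_neg {V T : E} {S : Sieve V} {t : T ⟶ V} (h : S t) (h' : negSieve S t) :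
    ⊥ ∈ extensiveTopology E T :=
  h' (𝟙 T) (by simpa using h)

lemma negSieve_pullback {V V' : E} (S : Sieve V) (f : V' ⟶ V) :
    negSieve (S.pullback f) = (negSieve S).pullback f := by
  ext T t
  simp [negSieve, Sieve.pullback]

lemma Decides.pullback {V V' : E} {S : Sieve V} (h : Decides S) (f : V' ⟶ V) :
    Decides (S.pullback f) := by
  have := (extensiveTopology E).pullback_stable f h
  refine GrothendieckTopology.superset_covering _ ?_ this
  rintro T t (ht | ht)
  · exact Or.inl ht
  · right
    rw [negSieve_pullback]
    exact ht

/-- A covering family may be used to prove that a sieve is decidable. -/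
lemma Decides.of_cover {V : E} {S R : Sieve V} (hR : R ∈ extensiveTopology E V)
    (h : ∀ ⦃T : E⦄ (t : T ⟶ V), R t → Decides (S.pullback t)) : Decides S := by
  refine (extensiveTopology E).transitive hR _ fun T t ht => ?_
  refine GrothendieckTopology.superset_covering _ ?_ (h t ht)
  rintro T' u (hu | hu)
  · exact Or.inl hu
  · right
    rw [negSieve_pullback] at hu
    exact hu

lemma decides_of_forall {V : E} {S : Sieve V} (h : S (𝟙 V)) : Decides S := by
  refine GrothendieckTopology.superset_covering _ le_sup_left ?_
  rw [(S.id_mem_iff_eq_top).1 h]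
  exact (extensiveTopology E).top_mem _

lemma decides_of_neg {V : E} {S : Sieve V} (h : negSieve S (𝟙 V)) : Decides S := by
  refine GrothendieckTopology.superset_covering _ le_sup_right ?_
  rw [(Sieve.id_mem_iff_eq_top).1 h]
  exact (extensiveTopology E).top_mem _

/-- Where `S` fails, so does the conjunction; hence `K` has to be decided only where `S` holds. -/
lemma Decides.inf_of {V : E} {S K : Sieve V} (hS : Decides S)
    (hK : ∀ ⦃T : E⦄ (t : T ⟶ V), S t → Decides (K.pullback t)) : Decides (S ⊓ K) := by
  refine Decides.of_cover hS ?_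
  rintro T t (ht | ht)
  · refine Decides.of_cover (hK t ht) ?_
    rintro T' u (hu | hu)
    · refine decides_of_forall ⟨?_, ?_⟩
      · simpa using S.downward_closed ht u
      · simpa using hu
    · refine decides_of_neg fun T'' u' hu' => ?_
      exact hu u' (by simpa using hu'.2)
  · refine decides_of_neg fun T'' u' hu' => ?_
    exact ht u' (by simpa using hu'.1)

lemma Decides.sup {V : E} {S K : Sieve V} (hS : Decides S) (hK : Decides K) :
    Decides (S ⊔ K) := by
  refine Decides.of_cover ((extensiveTopology E).intersection_covering hS hK) ?_
  rintro T t ⟨ht | ht, hk | hk⟩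
  · exact decides_of_forall (by simpa using Or.inl ht)
  · exact decides_of_forall (by simpa using Or.inl ht)
  · exact decides_of_forall (by simpa using Or.inr hk)
  · refine decides_of_neg ?_
    rintro T' u (hu | hu)
    · exact ht u (by simpa using hu)
    · exact hk u (by simpa using hu)

lemma decides_bot {V : E} : Decides (⊥ : Sieve V) :=
  decides_of_neg fun _ _ h => h.elim

lemma Decides.iSup {V : E} {ι : Type*} [Finite ι] {S : ι → Sieve V} (h : ∀ j, Decides (S j)) :
    Decides (⨆ j, S j) := by
  classical
  cases nonempty_fintype ι
  have : ∀ s : Finset ι, Decides (⨆ j ∈ s, S j) := by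
    intro s
    induction s using Finset.induction_on with
    | empty => simpa using decides_bot
    | insert a s _ ih =>
      rw [Finset.iSup_insert]
      exact (h a).sup ih
  simpa using this Finset.univ

lemma Decides.iInf {V : E} {ι : Type*} [Finite ι] {S : ι → Sieve V} (h : ∀ j, Decides (S j)) :
    Decides (⨅ j, S j) := by
  classical
  cases nonempty_fintype ι
  have : ∀ s : Finset ι, Decides (⨅ j ∈ s, S j) := by
    intro s
    induction s using Finset.induction_on with
    | empty => simpa using decides_of_forall (S := (⊤ : Sieve V)) trivial
    | insert a s _ ih =>
      rw [Finset.iInf_insert]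
      exact (h a).inf_of fun _ t _ => ih.pullback t
  simpa using this Finset.univ

/-- The sieve of morphisms which factor through a given morphism. -/
def factorSieve {U V : E} (f : U ⟶ V) : Sieve V where
  arrows T t := ∃ t' : T ⟶ U, t' ≫ f = t
  downward_closed := by
    rintro _ _ _ ⟨t', rfl⟩ u
    exact ⟨u ≫ t', by simp⟩

/-- A sieve is represented by a subobject if it consists of the morphisms which factor through
it. -/
def Represented {V : E} (S : Sieve V) : Prop :=
  ∃ (U : E) (f : U ⟶ V), Mono f ∧ S = factorSieve f

/-- Factorizations through a monomorphism are unique, so local ones glue. -/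
lemma Represented.of_cover {V : E} {S : Sieve V} (h : Represented S) {T : E} (t : T ⟶ V)
    {R : Sieve T} (hR : R ∈ extensiveTopology E T)
    (hRS : ∀ ⦃T' : E⦄ (u : T' ⟶ T), R u → S (u ≫ t)) : S t := by
  obtain ⟨U, f, _, rfl⟩ := h
  obtain ⟨w, hw, -⟩ := existsUnique_of_cover hR (W := U) (fun T' u w => w ≫ f = u ≫ t)
    (fun _ _ u t w hw => by simp [hw]) (fun T' u hu => by
      obtain ⟨w, hw⟩ := hRS u hu
      exact ⟨w, hw, fun w' hw' => by rw [← cancel_mono f, hw, hw']⟩)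
  exact ⟨w, hom_ext_of_cover hR fun T' u hu => by simpa using hw u hu⟩

section Coproducts

variable {U U' V : E} {f : U ⟶ V} {f' : U' ⟶ V}

lemma sup_factorSieve_mem (h : IsColimit (BinaryCofan.mk f f')) :
    factorSieve f ⊔ factorSieve f' ∈ extensiveTopology E V := by
  rw [extensiveTopology.mem_sieves_iff_contains_colimit_cofan]
  refine ⟨WalkingPair, inferInstance, fun j => WalkingPair.casesOn j U U',
    fun j => by cases j; exacts [f, f'], ⟨?_⟩, ?_⟩
  · refine Cofan.IsColimit.mk _ (fun s => BinaryCofan.IsColimit.desc' h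
      (s.inj .left) (s.inj .right) |>.1) ?_ ?_
    · rintro s (_ | _)
      · exact (BinaryCofan.IsColimit.desc' h (s.inj .left) (s.inj .right)).2.1
      · exact (BinaryCofan.IsColimit.desc' h (s.inj .left) (s.inj .right)).2.2
    · intro s m hm
      apply BinaryCofan.IsColimit.hom_ext h
      · exact (hm .left).trans
          (BinaryCofan.IsColimit.desc' h (s.inj .left) (s.inj .right)).2.1.symm
      · exact (hm .right).trans
          (BinaryCofan.IsColimit.desc' h (s.inj .left) (s.inj .right)).2.2.symm
  · rintro (_ | _)
    · exact Or.inl ⟨𝟙 _, by simp⟩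
    · exact Or.inr ⟨𝟙 _, by simp⟩

lemma bot_mem_of_isInitial {T : E} (h : IsInitial T) : ⊥ ∈ extensiveTopology E T := by
  rw [extensiveTopology.mem_sieves_iff_contains_colimit_cofan]
  refine ⟨PEmpty, inferInstance, PEmpty.elim, fun j => j.elim, ⟨?_⟩, fun j => j.elim⟩
  exact Cofan.IsColimit.mk _ (fun s => h.to _) (fun _ j => j.elim) (fun _ _ _ => h.hom_ext _ _)

/-- Coproducts are disjoint, so such a `T` maps to the initial object. -/
lemma bot_mem_of_factors (h : IsColimit (BinaryCofan.mk f f')) {T : E} (t : T ⟶ U) (t' : T ⟶ U')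
    (htt' : t ≫ f = t' ≫ f') : ⊥ ∈ extensiveTopology E T := by
  have hp := FinitaryExtensive.isPullback_initial_to_binaryCofan h
  exact bot_mem_of_hom (bot_mem_of_isInitial initialIsInitial) (hp.lift t t' htt')

lemma decides_factorSieve (h : IsColimit (BinaryCofan.mk f f')) : Decides (factorSieve f) := by
  refine GrothendieckTopology.superset_covering _ ?_ (sup_factorSieve_mem h)
  rintro T t (ht | ⟨t', rfl⟩)
  · exact Or.inl ht
  · right
    rintro T' u ⟨t, ht⟩
    exact bot_mem_of_factors h t (u ≫ t') (by simpa using ht)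

end Coproducts

/-- If a morphism `d : D ⟶ V` lifts along `D ⨿ V ⟶ V` compatibly with the first inclusion, then it
is a coproduct inclusion. -/
lemma exists_isColimit_binaryCofan [HasPullbacks E] {D V : E} (d : D ⟶ V) (h : V ⟶ D ⨿ V)
    (hd : d ≫ h = coprod.inl) (hh : h ≫ coprod.desc d (𝟙 V) = 𝟙 V) :
    ∃ (D' : E) (d' : D' ⟶ V), Nonempty (IsColimit (BinaryCofan.mk d d')) := by
  refine ⟨pullback h coprod.inr, pullback.fst _ _, ?_⟩
  -- The decomposition of `D ⨿ V` is pulled back along `h`; the summand over `coprod.inl` turns out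
  -- to be `D` itself.
  have hu := (FinitaryExtensive.vanKampen _ (coprodIsCoprod D V)).isUniversal
  have hP : IsPullback d (𝟙 D) h coprod.inl := by
    refine ⟨⟨by simp [hd]⟩, ⟨PullbackCone.IsLimit.mk _ (fun s => s.snd) ?_ ?_ ?_⟩⟩
    · intro s
      -- The retraction of `h` recovers the first leg of the cone from the second.
      have := s.condition =≫ coprod.desc d (𝟙 V)
      rw [Category.assoc, Category.assoc, coprod.inl_desc, hh, Category.comp_id] at this
      exact this.symm
    · intro s; simp
    · intro s m _ hm; simpa using hm
  refine hu (BinaryCofan.mk d (pullback.fst h coprod.inr))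
    (mapPair (𝟙 D) (pullback.snd h coprod.inr)) h ?_ (NatTrans.Equifibered.of_discrete _) ?_
  · ext (_ | _)
    · exact (Category.id_comp _).trans hd.symm
    · exact pullback.condition.symm
  · rintro ⟨_ | _⟩
    · exact hP
    · exact IsPullback.of_hasPullback _ _

end Topology

/-! ### Constructing and using enriched lifts. -/

section Lifts

variable {E : Type u} [Category.{v} E] [HasFiniteLimits E] {D : Type w} [Category.{w'} D]

/-- An enriched lift exists if every lifting problem has a unique lift satisfying a condition which
is stable under change of parameters. -/
lemma hasEnrichedLift_of_existsUnique {A B X Y : D ⥤ E} (i : A ⟶ B) (p : X ⟶ Y)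
    (Good : ∀ ⦃e : E⦄, (tensor e B ⟶ X) → Prop)
    (hGood : ∀ ⦃e e' : E⦄ (t : e' ⟶ e) (l : tensor e B ⟶ X), Good l →
      Good (tensorMapLeft t B ≫ l))
    (hex : ∀ (e : E) (a : tensor e A ⟶ X) (b : tensor e B ⟶ Y),
      a ≫ p = tensorMapRight e i ≫ b →
      ∃! l : tensor e B ⟶ X, tensorMapRight e i ≫ l = a ∧ l ≫ p = b ∧ Good l) :
    HasEnrichedLift i p := by
  choose L hL hLu using hex
  -- The restriction of a good lift is again a good lift, so uniqueness gives naturality of the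
  -- section.
  have hnat : ∀ ⦃e e' : E⦄ (t : e' ⟶ e) (x : (probPresheaf i p).obj (op e)),
      L e' (tensorMapLeft t A ≫ x.1.1) (tensorMapLeft t B ≫ x.1.2)
        (((probPresheaf i p).map t.op x).2) =
      tensorMapLeft t B ≫ L e x.1.1 x.1.2 x.2 := by
    intro e e' t x
    obtain ⟨h₁, h₂, h₃⟩ := hL e x.1.1 x.1.2 x.2
    refine (hLu e' _ _ _ _ ⟨?_, ?_, hGood t _ h₃⟩).symm
    · rw [← Category.assoc, ← tensorMap_comm, Category.assoc, h₁]
    · rw [Category.assoc, h₂]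
  let sec : probPresheaf i p ⟶ homPresheaf B X :=
    { app := fun e => ↾fun x => L e.unop x.1.1 x.1.2 x.2
      naturality := fun e e' t => by
        refine ConcreteCategory.hom_ext _ _ fun x => ?_
        exact hnat t.unop x }
  refine ⟨⟨⟨sec, ?_⟩⟩⟩
  ext e x
  exact Subtype.ext (Prod.ext (hL e.unop x.1.1 x.1.2 x.2).1 (hL e.unop x.1.1 x.1.2 x.2).2.1)

/-- A section of the pullback hom, unpacked. Restricted data enter the naturality clause through
equations, which avoids rewriting inside the dependent argument of `L`. -/
lemma HasEnrichedLift.exists_lift {A B X Y : D ⥤ E} {i : A ⟶ B} {p : X ⟶ Y}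
    (h : HasEnrichedLift i p) :
    ∃ L : ∀ (e : E) (a : tensor e A ⟶ X) (b : tensor e B ⟶ Y),
      a ≫ p = tensorMapRight e i ≫ b → (tensor e B ⟶ X),
      (∀ e a b hab, tensorMapRight e i ≫ L e a b hab = a) ∧
      (∀ e a b hab, L e a b hab ≫ p = b) ∧
      ∀ ⦃e e' : E⦄ (t : e' ⟶ e) (a : tensor e A ⟶ X) (b : tensor e B ⟶ Y)
        (a' : tensor e' A ⟶ X) (b' : tensor e' B ⟶ Y) (hab) (hab'),
        a' = tensorMapLeft t A ≫ a → b' = tensorMapLeft t B ≫ b →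
        L e' a' b' hab' = tensorMapLeft t B ≫ L e a b hab := by
  obtain ⟨⟨sec, hsec⟩⟩ := h
  refine ⟨fun e a b hab => sec.app (op e) ⟨(a, b), hab⟩, ?_, ?_, ?_⟩
  · intro e a b hab
    have := ConcreteCategory.congr_hom (NatTrans.congr_app hsec (op e)) ⟨(a, b), hab⟩
    exact congrArg (fun x => x.1.1) this
  · intro e a b hab
    have := ConcreteCategory.congr_hom (NatTrans.congr_app hsec (op e)) ⟨(a, b), hab⟩
    exact congrArg (fun x => x.1.2) this
  · rintro e e' t a b _ _ hab hab' rfl rfl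
    exact ConcreteCategory.congr_hom (sec.naturality t.op) ⟨(a, b), hab⟩

end Lifts

/-! ### Generalized elements of copowers of the terminal object. -/

section Points

variable {E : Type u} [Category.{v} E] [CountablyLextensive E]
variable {K L : SSet.{0}} [∀ m, Countable (K.obj m)] [∀ m, Countable (L.obj m)]

/-- The inclusion of `T` into `T × ∐_S 1` at an element of `S`. -/
noncomputable def copowerPoint (T : E) {S : Type} [Countable S] (s : S) :
    T ⟶ T ⨯ ∐ fun _ : S => ⊤_ E :=
  prod.lift (𝟙 T) (terminal.from T ≫ Sigma.ι (fun _ : S => ⊤_ E) s)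

lemma copowerPoint_fst (T : E) {S : Type} [Countable S] (s : S) :
    copowerPoint T s ≫ prod.fst = 𝟙 T :=
  prod.lift_fst _ _

lemma isPullback_copowerPoint (T : E) {S : Type} [Countable S] (s : S) :
    IsPullback (copowerPoint T s) (terminal.from T) prod.snd
      (Sigma.ι (fun _ : S => ⊤_ E) s) := by
  refine ⟨⟨prod.lift_snd _ _⟩, ⟨PullbackCone.IsLimit.mk _ (fun c => c.fst ≫ prod.fst) ?_ ?_ ?_⟩⟩
  · intro c
    refine Limits.prod.hom_ext ?_ ?_
    · rw [Category.assoc, copowerPoint_fst, Category.comp_id]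
    · simp only [copowerPoint, Category.assoc, prod.lift_snd, c.condition]
      simp only [← Category.assoc]
      congr 1
      exact Subsingleton.elim _ _
  · intro c
    exact Subsingleton.elim _ _
  · intro c f hf _
    rw [← hf, Category.assoc, copowerPoint_fst, Category.comp_id]

/-- Universality of the coproduct `∐_S 1`, pulled back along `T × ∐_S 1 ⟶ ∐_S 1`. It lets a morphism
out of `T × K` be prescribed simplex by simplex. -/
lemma nonempty_isColimit_copowerPoint (T : E) (S : Type) [Countable S] :
    Nonempty (IsColimit (Cofan.mk _ fun s : S => copowerPoint T s)) := by
  have hu := (CountablyLextensive.vanKampen (E := E) _ _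
    (coproductIsCoproduct fun _ : S => ⊤_ E)).isUniversal
  refine hu (Cofan.mk _ fun s : S => copowerPoint T s)
    (Discrete.natTrans fun s => terminal.from T) prod.snd ?_ (NatTrans.Equifibered.of_discrete _) ?_
  · ext ⟨s⟩
    exact (prod.lift_snd _ _).symm
  · rintro ⟨s⟩
    exact isPullback_copowerPoint T s

lemma copowerPoint_map (T : E) {S S' : Type} [Countable S] [Countable S'] (s : S) (f : S → S') :
    copowerPoint T s ≫ prod.map (𝟙 T) (Sigma.desc fun s => Sigma.ι (fun _ : S' => ⊤_ E) (f s)) =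
      copowerPoint T (f s) := by
  apply Limits.prod.hom_ext <;> simp [copowerPoint]

lemma copowerPoint_map_left {T T' : E} (t : T' ⟶ T) {S : Type} [Countable S] (s : S) :
    copowerPoint T' s ≫ prod.map t (𝟙 (∐ fun _ : S => ⊤_ E)) = t ≫ copowerPoint T s := by
  apply Limits.prod.hom_ext <;> simp [copowerPoint, ← Category.assoc]

/-- The inclusion of `T` into `T × ∐_{K_m} 1` at an element of `K_m`. -/
noncomputable def simplexPoint (T : E) {m : SimplexCategoryᵒᵖ} (s : K.obj m) :
    T ⟶ (tensor T (fset E K)).obj m :=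
  copowerPoint T s

lemma nonempty_isColimit_simplexPoint (T : E) (m : SimplexCategoryᵒᵖ) :
    Nonempty (IsColimit (Cofan.mk _ fun s : K.obj m => simplexPoint T s)) :=
  nonempty_isColimit_copowerPoint T (K.obj m)

lemma tensor_hom_ext {T W : E} {m : SimplexCategoryᵒᵖ} {f g : (tensor T (fset E K)).obj m ⟶ W}
    (h : ∀ s : K.obj m, simplexPoint T s ≫ f = simplexPoint T s ≫ g) : f = g :=
  Cofan.IsColimit.hom_ext (nonempty_isColimit_simplexPoint T m).some _ _ h

/-- The morphism out of `T × ∐_{K_m} 1` with given components. -/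
noncomputable def tensorDesc {T W : E} {m : SimplexCategoryᵒᵖ} (φ : K.obj m → (T ⟶ W)) :
    (tensor T (fset E K)).obj m ⟶ W :=
  Cofan.IsColimit.desc (nonempty_isColimit_simplexPoint T m).some φ

lemma simplexPoint_tensorDesc {T W : E} {m : SimplexCategoryᵒᵖ} (φ : K.obj m → (T ⟶ W))
    (s : K.obj m) : simplexPoint T s ≫ tensorDesc φ = φ s :=
  Cofan.IsColimit.fac (nonempty_isColimit_simplexPoint T m).some φ s

lemma simplexPoint_map (T : E) {m m' : SimplexCategoryᵒᵖ} (s : K.obj m) (f : m ⟶ m') :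
    simplexPoint T s ≫ (tensor T (fset E K)).map f = simplexPoint T (K.map f s) :=
  copowerPoint_map T s (K.map f)

lemma simplexPoint_tensorMapRight (T : E) {m : SimplexCategoryᵒᵖ} (s : K.obj m) (k : K ⟶ L) :
    simplexPoint T s ≫ (tensorMapRight T (fsetMap E k)).app m = simplexPoint T (k.app m s) :=
  copowerPoint_map T s (k.app m)

lemma simplexPoint_tensorMapLeft {T T' : E} (t : T' ⟶ T) {m : SimplexCategoryᵒᵖ} (s : K.obj m) :
    simplexPoint T' s ≫ (tensorMapLeft t (fset E K)).app m = t ≫ simplexPoint T s :=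
  copowerPoint_map_left t s

/-- The morphism out of `T × K` given by a natural family of morphisms indexed by the simplices
of `K`. -/
noncomputable def simplicialDesc {T : E} {P : SimplicialObject E}
    (φ : ∀ m, K.obj m → (T ⟶ P.obj m))
    (hφ : ∀ ⦃m m'⦄ (f : m ⟶ m') (s : K.obj m), φ m s ≫ P.map f = φ m' (K.map f s)) :
    tensor T (fset E K) ⟶ P where
  app m := tensorDesc (φ m)
  naturality m m' f := by
    apply tensor_hom_ext
    intro s
    rw [← Category.assoc, simplexPoint_map, simplexPoint_tensorDesc, ← Category.assoc,
      simplexPoint_tensorDesc, hφ]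

lemma simplexPoint_simplicialDesc {T : E} {P : SimplicialObject E}
    (φ : ∀ m, K.obj m → (T ⟶ P.obj m)) (hφ) {m : SimplexCategoryᵒᵖ} (s : K.obj m) :
    simplexPoint T s ≫ (simplicialDesc φ hφ).app m = φ m s :=
  simplexPoint_tensorDesc _ _

lemma tensor_fset_hom_ext {T : E} {P : SimplicialObject E} {f g : tensor T (fset E K) ⟶ P}
    (h : ∀ (m) (s : K.obj m), simplexPoint T s ≫ f.app m = simplexPoint T s ≫ g.app m) : f = g := by
  ext m
  exact tensor_hom_ext (h m)

end Points

/-! ### Ordinary lifts from enriched ones. -/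

section OrdinaryLifts

variable {E : Type u} [Category.{v} E] [HasFiniteLimits E] {D : Type w} [Category.{w'} D]

/-- The projection `e × X ⟶ X`. -/
noncomputable def tensorSnd (e : E) (X : D ⥤ E) : tensor e X ⟶ X where
  app d := (prod.snd : e ⨯ X.obj d ⟶ X.obj d)
  naturality _ _ f := prod.map_snd (𝟙 e) (X.map f)

/-- The inclusion `X ⟶ 1 × X`. -/
noncomputable def tensorUnit (X : D ⥤ E) : X ⟶ tensor (⊤_ E) X where
  app d := prod.lift (terminal.from (X.obj d)) (𝟙 _)
  naturality d d' f := by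
    change X.map f ≫ prod.lift _ _ = prod.lift _ _ ≫ prod.map (𝟙 _) (X.map f)
    rw [prod.lift_map]
    apply Limits.prod.hom_ext
    · exact Subsingleton.elim (α := _ ⟶ ⊤_ E) _ _
    · simp

lemma tensorUnit_snd (X : D ⥤ E) : tensorUnit X ≫ tensorSnd _ X = 𝟙 X := by
  ext d
  exact prod.lift_snd _ _

lemma tensorMapRight_snd (e : E) {X Y : D ⥤ E} (f : X ⟶ Y) :
    tensorMapRight e f ≫ tensorSnd e Y = tensorSnd e X ≫ f := by
  ext d
  exact prod.map_snd (𝟙 e) (f.app d)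

lemma tensorUnit_naturality {X Y : D ⥤ E} (f : X ⟶ Y) :
    tensorUnit X ≫ tensorMapRight _ f = f ≫ tensorUnit Y := by
  ext d
  change prod.lift _ _ ≫ prod.map (𝟙 _) (f.app d) = f.app d ≫ prod.lift _ _
  rw [prod.lift_map]
  apply Limits.prod.hom_ext
  · exact Subsingleton.elim (α := _ ⟶ ⊤_ E) _ _
  · simp

lemma HasEnrichedLift.exists_ordinary_lift {A B X Y : D ⥤ E} {i : A ⟶ B} {p : X ⟶ Y}
    (h : HasEnrichedLift i p) (a : A ⟶ X) (b : B ⟶ Y) (hab : a ≫ p = i ≫ b) :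
    ∃ l : B ⟶ X, i ≫ l = a ∧ l ≫ p = b := by
  obtain ⟨L, h₁, h₂, -⟩ := h.exists_lift
  have hab' : (tensorSnd (⊤_ E) A ≫ a) ≫ p = tensorMapRight (⊤_ E) i ≫ tensorSnd (⊤_ E) B ≫ b := by
    rw [Category.assoc, hab, ← Category.assoc (tensorMapRight _ _), tensorMapRight_snd,
      Category.assoc]
  refine ⟨tensorUnit B ≫ L _ _ _ hab', ?_, ?_⟩
  · rw [← Category.assoc, ← tensorUnit_naturality, Category.assoc, h₁, ← Category.assoc,
      tensorUnit_snd, Category.id_comp]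
  · rw [Category.assoc, h₂, ← Category.assoc, tensorUnit_snd, Category.id_comp]

end OrdinaryLifts

/-! ### Coinduced simplicial objects and classifiers of lifts. -/

section Coinduced

variable {E : Type u} [Category.{v} E] [HasFiniteLimits E]

instance (a b : SimplexCategoryᵒᵖ) : Finite (a ⟶ b) :=
  Finite.of_equiv (b.unop ⟶ a.unop) (opEquiv a b).symm

/-- The simplicial object cofreely generated by an object of `E` in a given degree. -/
noncomputable def coinduced (n : SimplexCategoryᵒᵖ) (Z : E) : SimplicialObject E :=
  (evaluationRightAdjoint E n).obj Z

/-- Morphisms into a coinduced simplicial object. -/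
noncomputable def coinducedEquiv (n : SimplexCategoryᵒᵖ) (Z : E) (V : SimplicialObject E) :
    (V.obj n ⟶ Z) ≃ (V ⟶ coinduced n Z) :=
  (evaluationAdjunctionLeft E n).homEquiv V Z

/-- The evaluation of a coinduced simplicial object. -/
noncomputable def coinducedCounit (n : SimplexCategoryᵒᵖ) (Z : E) : (coinduced n Z).obj n ⟶ Z :=
  (evaluationAdjunctionLeft E n).counit.app Z

lemma coinducedEquiv_counit {n : SimplexCategoryᵒᵖ} {Z : E} {V : SimplicialObject E}
    (f : V.obj n ⟶ Z) : (coinducedEquiv n Z V f).app n ≫ coinducedCounit n Z = f :=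
  ((evaluationAdjunctionLeft E n).homEquiv_counit _ _ _).symm.trans
    ((coinducedEquiv n Z V).symm_apply_apply f)

lemma coinduced_hom_ext {n : SimplexCategoryᵒᵖ} {Z : E} {V : SimplicialObject E}
    {f g : V ⟶ coinduced n Z}
    (h : f.app n ≫ coinducedCounit n Z = g.app n ≫ coinducedCounit n Z) : f = g := by
  apply (coinducedEquiv n Z V).symm.injective
  exact ((evaluationAdjunctionLeft E n).homEquiv_counit _ _ _).trans
    (h.trans ((evaluationAdjunctionLeft E n).homEquiv_counit _ _ _).symm)

/-- The simplicial object over `X` classifying lifts of the `n`-simplices of `X` along a morphism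
`π`, subject to a condition on the simplices in the image of a simplicial operator. -/
lemma exists_classifier (X : SimplicialObject E) {m n : SimplexCategoryᵒᵖ} (s : m ⟶ n)
    {Z Z' : E} (π : Z ⟶ X.obj n) (ζ : Z ⟶ Z') (k : X.obj m ⟶ Z') :
    ∃ (P : SimplicialObject E) (p : P ⟶ X) (z : P.obj n ⟶ Z),
      z ≫ π = p.app n ∧ P.map s ≫ z ≫ ζ = p.app m ≫ k ∧
      ∀ (V : SimplicialObject E) (a : V ⟶ X) (h : V.obj n ⟶ Z), h ≫ π = a.app n →
        V.map s ≫ h ≫ ζ = a.app m ≫ k → ∃! l : V ⟶ P, l ≫ p = a ∧ l.app n ≫ z = h := by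
  have : HasBinaryProducts (SimplicialObject E) :=
    inferInstanceAs (HasBinaryProducts (SimplexCategoryᵒᵖ ⥤ E))
  have : HasPullbacks (SimplicialObject E) :=
    inferInstanceAs (HasPullbacks (SimplexCategoryᵒᵖ ⥤ E))
  -- `P` will be a pullback of `X` and `coinduced n Z` over a product of two coinduced objects: the
  -- first factor expresses that the lift lies over the simplex of `X`, the second the condition
  -- along `s`.
  let f₁ : X ⟶ coinduced n (X.obj n) := coinducedEquiv _ _ _ (𝟙 _)
  let f₂ : X ⟶ coinduced m Z' := coinducedEquiv _ _ _ k
  let g₁ : coinduced n Z ⟶ coinduced n (X.obj n) := coinducedEquiv _ _ _ (coinducedCounit n Z ≫ π)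
  let g₂ : coinduced n Z ⟶ coinduced m Z' :=
    coinducedEquiv _ _ _ ((coinduced n Z).map s ≫ coinducedCounit n Z ≫ ζ)
  let f := prod.lift f₁ f₂
  let g := prod.lift g₁ g₂
  have key : ∀ (V : SimplicialObject E) (a : V ⟶ X) (c : V ⟶ coinduced n Z), a ≫ f = c ≫ g ↔
      (c.app n ≫ coinducedCounit n Z) ≫ π = a.app n ∧
      V.map s ≫ (c.app n ≫ coinducedCounit n Z) ≫ ζ = a.app m ≫ k := by
    intro V a c
    have e₁ : a ≫ f₁ = c ≫ g₁ ↔ (c.app n ≫ coinducedCounit n Z) ≫ π = a.app n := by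
      have h₁ : (a ≫ f₁).app n ≫ coinducedCounit n _ = a.app n := by
        rw [NatTrans.comp_app, Category.assoc, coinducedEquiv_counit, Category.comp_id]
      have h₂ : (c ≫ g₁).app n ≫ coinducedCounit n _ = (c.app n ≫ coinducedCounit n Z) ≫ π := by
        rw [NatTrans.comp_app, Category.assoc, coinducedEquiv_counit, Category.assoc]
      rw [← h₁, ← h₂]
      exact ⟨fun h => by rw [h], fun h => coinduced_hom_ext h.symm⟩
    have e₂ : a ≫ f₂ = c ≫ g₂ ↔
        V.map s ≫ (c.app n ≫ coinducedCounit n Z) ≫ ζ = a.app m ≫ k := by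
      have h₁ : (a ≫ f₂).app m ≫ coinducedCounit m _ = a.app m ≫ k := by
        rw [NatTrans.comp_app, Category.assoc, coinducedEquiv_counit]
      have h₂ : (c ≫ g₂).app m ≫ coinducedCounit m _ =
          V.map s ≫ (c.app n ≫ coinducedCounit n Z) ≫ ζ := by
        rw [NatTrans.comp_app, Category.assoc, coinducedEquiv_counit, Category.assoc,
          ← Category.assoc, ← c.naturality, Category.assoc]
      rw [← h₁, ← h₂]
      exact ⟨fun h => by rw [h], fun h => coinduced_hom_ext h.symm⟩
    rw [← e₁, ← e₂, prod.comp_lift, prod.comp_lift]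
    constructor
    · intro h
      have h₁ := h =≫ prod.fst
      have h₂ := h =≫ prod.snd
      rw [prod.lift_fst, prod.lift_fst] at h₁
      rw [prod.lift_snd, prod.lift_snd] at h₂
      exact ⟨h₁, h₂⟩
    · rintro ⟨h₁, h₂⟩
      rw [h₁, h₂]
  have hP := (key _ _ _).1 (pullback.condition (f := f) (g := g))
  refine ⟨pullback f g, pullback.fst f g, (pullback.snd f g).app n ≫ coinducedCounit n Z,
    hP.1, hP.2, ?_⟩
  intro V a h h₁ h₂
  have hc := coinducedEquiv_counit (V := V) h
  have hac : a ≫ f = coinducedEquiv _ _ _ h ≫ g := by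
    rw [key, hc]
    exact ⟨h₁, h₂⟩
  refine ⟨pullback.lift _ _ hac, ⟨pullback.lift_fst _ _ _, ?_⟩, ?_⟩
  · rw [← Category.assoc, ← NatTrans.comp_app, pullback.lift_snd]
    exact hc
  · rintro l ⟨hl₁, hl₂⟩
    apply pullback.hom_ext
    · rw [hl₁, pullback.lift_fst]
    · rw [pullback.lift_snd]
      apply coinduced_hom_ext
      rw [hc, ← hl₂, NatTrans.comp_app, Category.assoc]

end Coinduced

/-! ### Coproduct decompositions obtained by lifting against classifiers. -/

section TestFibrations

variable {E : Type u} [Category.{v} E] [CountablyLextensive E]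

/-- A classifier of lifts has the enriched right lifting property against the inclusions of
simplicial sets if the lifting conditions have solutions. -/
lemma hasEnrichedLift_of_classifier {K : SSet.{0}} (S : K.Subcomplex) [∀ m, Countable (K.obj m)]
    [∀ m, Countable ((S : SSet.{0}).obj m)] {X P : SimplicialObject E} {m n : SimplexCategoryᵒᵖ}
    (s : m ⟶ n) (r : n ⟶ m) (hsr : s ≫ r = 𝟙 m) {Z Z' : E} (π : Z ⟶ X.obj n) (ζ : Z ⟶ Z')
    (k : X.obj m ⟶ Z') (p : P ⟶ X) (z : P.obj n ⟶ Z) (hz : z ≫ π = p.app n)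
    (hsz : P.map s ≫ z ≫ ζ = p.app m ≫ k)
    (hP : ∀ (V : SimplicialObject E) (a : V ⟶ X) (h : V.obj n ⟶ Z), h ≫ π = a.app n →
      V.map s ≫ h ≫ ζ = a.app m ≫ k → ∃! l : V ⟶ P, l ≫ p = a ∧ l.app n ≫ z = h)
    (r₁ : X.obj n ⟶ Z) (hr₁ : r₁ ≫ π = 𝟙 _) (r₂ : X.obj m ⟶ Z) (hr₂ : r₂ ≫ π = X.map s)
    (hr₂' : r₂ ≫ ζ = k) : HasEnrichedLift (fsetMap E S.ι) p := by
  classical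
  -- The default lift at a simplex: on the image of `s`, the section `r₂` is needed to meet the
  -- condition on `ζ`; elsewhere any section of `π` will do.
  let φ : ∀ (e : E) (b : tensor e (fset E K) ⟶ X) (τ : K.obj n), e ⟶ Z := fun e b τ =>
    if h : ∃ τ' : K.obj m, K.map s τ' = τ then simplexPoint e h.choose ≫ b.app m ≫ r₂
    else simplexPoint e τ ≫ b.app n ≫ r₁
  have hs : ∀ τ τ' : K.obj m, K.map s τ = K.map s τ' → τ = τ' := by
    intro τ τ' h
    have := congrArg (K.map r) h
    rw [← Functor.map_comp_apply, ← Functor.map_comp_apply, hsr] at this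
    simpa using this
  have hφs : ∀ e b (τ : K.obj m), φ e b (K.map s τ) = simplexPoint e τ ≫ b.app m ≫ r₂ := by
    intro e b τ
    have h : ∃ τ' : K.obj m, K.map s τ' = K.map s τ := ⟨τ, rfl⟩
    simp only [φ, dif_pos h]
    rw [hs _ _ h.choose_spec]
  have hφπ : ∀ e b (τ : K.obj n), φ e b τ ≫ π = simplexPoint e τ ≫ b.app n := by
    intro e b τ
    by_cases h : ∃ τ' : K.obj m, K.map s τ' = τ
    · obtain ⟨τ', rfl⟩ := h
      rw [hφs, Category.assoc, Category.assoc, hr₂, ← b.naturality, ← Category.assoc,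
        simplexPoint_map]
    · simp only [φ, dif_neg h, Category.assoc, hr₁, Category.comp_id]
  refine hasEnrichedLift_of_existsUnique _ p
    (fun e l => ∀ τ : K.obj n, τ ∉ S.obj n →
      simplexPoint e τ ≫ l.app n ≫ z = φ e (l ≫ p) τ) ?_ ?_
  · intro e e' t l hl τ hτ
    have hφt : φ e' ((tensorMapLeft t _ ≫ l) ≫ p) τ = t ≫ φ e (l ≫ p) τ := by
      by_cases h : ∃ τ' : K.obj m, K.map s τ' = τ
      · simp only [φ, dif_pos h, NatTrans.comp_app, ← Category.assoc]
        rw [simplexPoint_tensorMapLeft]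
      · simp only [φ, dif_neg h, NatTrans.comp_app, ← Category.assoc]
        rw [simplexPoint_tensorMapLeft]
    rw [hφt, ← hl τ hτ, NatTrans.comp_app, Category.assoc, ← Category.assoc,
      simplexPoint_tensorMapLeft, Category.assoc]
  · intro e a b hab
    -- On `S` the lift is dictated by `a`; outside `S` it takes the default value.
    let ψ : K.obj n → (e ⟶ Z) := fun τ =>
      if h : τ ∈ S.obj n then
        simplexPoint (K := (S : SSet.{0})) e ⟨τ, h⟩ ≫ a.app n ≫ z
      else φ e b τ
    have hab' : ∀ (j) (τ : (S : SSet.{0}).obj j),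
        simplexPoint e τ ≫ a.app j ≫ p.app j = simplexPoint e τ.1 ≫ b.app j := by
      intro j τ
      rw [← NatTrans.comp_app, hab, NatTrans.comp_app, ← Category.assoc,
        simplexPoint_tensorMapRight]
      rfl
    have hsa : ∀ τ : (S : SSet.{0}).obj m, simplexPoint e ((S : SSet.{0}).map s τ) ≫
        a.app n ≫ z ≫ ζ = simplexPoint e τ.1 ≫ b.app m ≫ k := by
      intro τ
      rw [← simplexPoint_map, Category.assoc, ← Category.assoc (CategoryTheory.Functor.map _ s), a.naturality,
        Category.assoc, hsz, ← Category.assoc (simplexPoint e τ.1), ← hab' m τ]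
      simp only [Category.assoc]
    have hψπ : ∀ τ, ψ τ ≫ π = simplexPoint e τ ≫ b.app n := by
      intro τ
      by_cases h : τ ∈ S.obj n
      · simp only [ψ, dif_pos h, Category.assoc, hz]
        exact hab' n ⟨τ, h⟩
      · simp only [ψ, dif_neg h, hφπ]
    have hψζ : ∀ τ : K.obj m, ψ (K.map s τ) ≫ ζ = simplexPoint e τ ≫ b.app m ≫ k := by
      intro τ
      by_cases h : K.map s τ ∈ S.obj n
      -- Applying `r` shows that `τ` lies in `S` as soon as its image under `s` does, so the two
      -- cases of `ψ` are compatible with the condition along `s`.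
      · have hτ : τ ∈ S.obj m := by
          have := S.map r h
          rw [Set.mem_preimage, ← Functor.map_comp_apply, hsr] at this
          simpa using this
        simp only [ψ, dif_pos h, Category.assoc]
        exact hsa ⟨τ, hτ⟩
      · simp only [ψ, dif_neg h, hφs, Category.assoc, hr₂']
    obtain ⟨l, ⟨hl₁, hl₂⟩, hlu⟩ := hP (tensor e (fset E K)) b (tensorDesc ψ)
      (tensor_hom_ext fun τ => by rw [← Category.assoc, simplexPoint_tensorDesc, hψπ])
      (tensor_hom_ext fun τ => by
        rw [← Category.assoc, simplexPoint_map, ← Category.assoc, simplexPoint_tensorDesc, hψζ])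
    refine ⟨l, ⟨?_, hl₁, ?_⟩, ?_⟩
    · have hi₁ : (tensorMapRight e (fsetMap E S.ι) ≫ l).app n ≫ z =
          a.app n ≫ z := by
        apply tensor_hom_ext
        intro τ
        rw [NatTrans.comp_app, Category.assoc, hl₂, ← Category.assoc, simplexPoint_tensorMapRight,
          simplexPoint_tensorDesc]
        exact dif_pos τ.2
      refine (hP _ (a ≫ p) (a.app n ≫ z) ?_ ?_).unique ⟨?_, hi₁⟩ ⟨rfl, rfl⟩
      · rw [Category.assoc, hz, NatTrans.comp_app]
      · rw [NatTrans.comp_app, Category.assoc, Category.assoc, ← hsz, ← Category.assoc,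
          a.naturality, Category.assoc]
      · rw [Category.assoc, hl₁, hab]
    · intro τ hτ
      rw [hl₁, hl₂, simplexPoint_tensorDesc]
      exact dif_neg hτ
    · rintro l' ⟨h₁, h₂, h₃⟩
      have hla : ∀ τ : (S : SSet.{0}).obj n, simplexPoint e τ.1 ≫ l'.app n ≫ z =
          simplexPoint e τ ≫ a.app n ≫ z := by
        intro τ
        rw [← h₁, NatTrans.comp_app, Category.assoc, ← Category.assoc (simplexPoint e τ),
          simplexPoint_tensorMapRight]
        rfl
      refine hlu l' ⟨h₂, tensor_hom_ext fun τ => ?_⟩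
      rw [simplexPoint_tensorDesc]
      by_cases h : τ ∈ S.obj n
      · simp only [ψ, dif_pos h]
        exact hla ⟨τ, h⟩
      · simp only [ψ, dif_neg h]
        rw [h₃ τ h, h₂]

/-- The lifting property of a cofibration against the classifiers of lifts. -/
lemma Cofibration.exists_lift {A B : SimplicialObject E} {i : A ⟶ B} (hi : Cofibration i)
    {m n : SimplexCategoryᵒᵖ} (s : m ⟶ n) (r : n ⟶ m) (hsr : s ≫ r = 𝟙 m) {Z Z' : E}
    (π : Z ⟶ B.obj n) (ζ : Z ⟶ Z') (k : B.obj m ⟶ Z') (r₁ : B.obj n ⟶ Z) (hr₁ : r₁ ≫ π = 𝟙 _)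
    (r₂ : B.obj m ⟶ Z) (hr₂ : r₂ ≫ π = B.map s) (hr₂' : r₂ ≫ ζ = k)
    (h₀ : A.obj n ⟶ Z) (hπ : h₀ ≫ π = i.app n) (hζ : A.map s ≫ h₀ ≫ ζ = i.app m ≫ k) :
    ∃ h : B.obj n ⟶ Z, i.app n ≫ h = h₀ ∧ h ≫ π = 𝟙 _ ∧ B.map s ≫ h ≫ ζ = k := by
  obtain ⟨P, p, z, hz, hsz, hP⟩ := exists_classifier B s π ζ k
  have hp : enrichedFibrations (boundaryInclusions E) p := by
    rintro _ _ _ ⟨N⟩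
    exact hasEnrichedLift_of_classifier _ s r hsr π ζ k p z hz hsz hP r₁ hr₁ r₂ hr₂ hr₂'
  obtain ⟨a, ⟨ha₁, ha₂⟩, -⟩ := hP A i h₀ hπ hζ
  obtain ⟨l, hl₁, hl₂⟩ := (hi p hp).exists_ordinary_lift a (𝟙 B) (by rw [ha₁, Category.comp_id])
  refine ⟨l.app n ≫ z, ?_, ?_, ?_⟩
  · rw [← Category.assoc, ← NatTrans.comp_app, hl₁, ha₂]
  · rw [Category.assoc, hz, ← NatTrans.comp_app, hl₂, NatTrans.id_app]
  · rw [Category.assoc, ← Category.assoc, l.naturality, Category.assoc, hsz, ← Category.assoc,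
      ← NatTrans.comp_app, hl₂, NatTrans.id_app, Category.id_comp]

/-- A cofibration is levelwise a coproduct inclusion. -/
lemma Cofibration.exists_complement {A B : SimplicialObject E} {i : A ⟶ B} (hi : Cofibration i)
    (n : SimplexCategoryᵒᵖ) :
    ∃ (C : E) (c : C ⟶ B.obj n), Nonempty (IsColimit (BinaryCofan.mk (i.app n) c)) := by
  -- Here `Z = A_n ⨿ B_n`, and the condition along `s` is made vacuous by taking `Z'` terminal.
  obtain ⟨h, h₁, h₂, -⟩ := hi.exists_lift (𝟙 n) (𝟙 n) (by simp)
    (coprod.desc (i.app n) (𝟙 (B.obj n))) (terminal.from _) (terminal.from _) coprod.inr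
    (coprod.inr_desc _ _) coprod.inr (by rw [coprod.inr_desc, B.map_id]) (Subsingleton.elim _ _)
    coprod.inl (coprod.inl_desc _ _) (Subsingleton.elim _ _)
  exact exists_isColimit_binaryCofan (i.app n) h h₁ h₂

/-- The degeneracy operators of a cofibrant object are coproduct inclusions. -/
lemma Cofibrant.exists_complement {X : SimplicialObject E} (hX : Cofibrant X)
    {m n : SimplexCategoryᵒᵖ} (s : m ⟶ n) (r : n ⟶ m) (hsr : s ≫ r = 𝟙 m) :
    ∃ (C : E) (c : C ⟶ X.obj n), Nonempty (IsColimit (BinaryCofan.mk (X.map s) c)) := by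
  have hinit : ∀ j : SimplexCategoryᵒᵖ, Nonempty (IsInitial ((⊥_ (SimplicialObject E)).obj j)) :=
    fun j => ⟨IsInitial.isInitialObj ((evaluation SimplexCategoryᵒᵖ E).obj j) _
      (initialIsInitial (C := SimplicialObject E))⟩
  -- Here `Z = X_m ⨿ X_n` with `ζ` the identity and `k` the first inclusion, so that `h` sends
  -- degenerate simplices to the first summand; the source of the cofibration is levelwise initial.
  obtain ⟨h, -, h₂, h₃⟩ := Cofibration.exists_lift hX s r hsr
    (coprod.desc (X.map s) (𝟙 (X.obj n))) (𝟙 _) coprod.inl coprod.inr (coprod.inr_desc _ _)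
    coprod.inl (coprod.inl_desc _ _) (Category.comp_id _) ((hinit n).some.to _) ((hinit n).some.hom_ext _ _)
    ((hinit m).some.hom_ext _ _)
  exact exists_isColimit_binaryCofan (X.map s) h (by simpa using h₃) h₂

end TestFibrations

/-! ### Factorizations in the simplex category and extension from low dimensions. -/

section Factorization

/-- Every morphism of the simplex category is a split epimorphism followed by a monomorphism. -/
lemma exists_splitEpi_mono {m n : SimplexCategory} (σ : m ⟶ n) :
    ∃ (k : SimplexCategory) (ε : m ⟶ k) (δ : k ⟶ n) (γ : k ⟶ m),
      ε ≫ δ = σ ∧ γ ≫ ε = 𝟙 k ∧ Mono δ ∧ k.len ≤ n.len ∧ (¬ Epi σ → k.len < n.len) := by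
  have : IsSplitEpi (factorThruImage σ) := isSplitEpi_of_epi _
  refine ⟨image σ, factorThruImage σ, image.ι σ, section_ (factorThruImage σ), image.fac σ,
    IsSplitEpi.id _, inferInstance, SimplexCategory.len_le_of_mono (image.ι σ), fun h => ?_⟩
  refine lt_of_le_of_ne (SimplexCategory.len_le_of_mono (image.ι σ)) fun h' => h ?_
  have := (SimplexCategory.isIso_iff_of_mono (image.ι σ)).2 h'
  rw [← image.fac σ]
  infer_instance

/-- A natural family indexed by the simplices of low dimension in a sieve on `n` extends uniquely to
all the simplices in the sieve. -/
lemma existsUnique_extension {W : SimplexCategory → Type w}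
    (act : ∀ ⦃m' m : SimplexCategory⦄, (m' ⟶ m) → W m → W m')
    (act_comp : ∀ ⦃m'' m' m : SimplexCategory⦄ (ρ' : m'' ⟶ m') (ρ : m' ⟶ m) (x : W m),
      act ρ' (act ρ x) = act (ρ' ≫ ρ) x)
    {n : SimplexCategory} (S : ∀ ⦃m : SimplexCategory⦄, (m ⟶ n) → Prop)
    (hS : ∀ ⦃m' m : SimplexCategory⦄ (ρ : m' ⟶ m) (σ : m ⟶ n), S σ → S (ρ ≫ σ))
    (low : SimplexCategory → Prop)
    (hlow : ∀ ⦃m : SimplexCategory⦄ (σ : m ⟶ n), S σ →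
      ∃ (k : SimplexCategory) (ε : m ⟶ k) (δ : k ⟶ n) (γ : k ⟶ m),
        ε ≫ δ = σ ∧ γ ≫ ε = 𝟙 k ∧ Mono δ ∧ low k)
    (x : ∀ (m : SimplexCategory) (σ : m ⟶ n), S σ → low m → W m)
    (hx : ∀ (m' m : SimplexCategory) (ρ : m' ⟶ m) (σ : m ⟶ n) (h : S σ) (hm : low m)
      (hm' : low m'), x m' (ρ ≫ σ) (hS ρ σ h) hm' = act ρ (x m σ h hm)) :
    ∃! y : ∀ (m : SimplexCategory) (σ : m ⟶ n), S σ → W m,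
      (∀ (m' m : SimplexCategory) (ρ : m' ⟶ m) (σ : m ⟶ n) (h : S σ),
        y m' (ρ ≫ σ) (hS ρ σ h) = act ρ (y m σ h)) ∧
      ∀ (m : SimplexCategory) (σ : m ⟶ n) (h : S σ) (hm : low m), y m σ h = x m σ h hm := by
  choose k ε δ γ h₁ h₂ h₃ h₄ using hlow
  have hSδ : ∀ ⦃m : SimplexCategory⦄ (σ : m ⟶ n) (h : S σ), S (δ σ h) := by
    intro m σ h
    have : δ σ h = γ σ h ≫ σ := by
      have := congrArg (γ σ h ≫ ·) (h₁ σ h)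
      simpa only [← Category.assoc, h₂, Category.id_comp] using this
    rw [this]
    exact hS _ _ h
  -- Independence of the factorization: with `b` monic and `a'` split by `c'`, the second
  -- factorization is obtained from the first, as `b' = (c' ≫ a) ≫ b` and `a = a' ≫ c' ≫ a`.
  have key : ∀ ⦃m j k' : SimplexCategory⦄ (a : m ⟶ j) (b : j ⟶ n) (_ : Mono b) (hb : S b)
      (hj : low j) (a' : m ⟶ k') (b' : k' ⟶ n) (c' : k' ⟶ m) (hb' : S b') (hk' : low k'),
      c' ≫ a' = 𝟙 k' → a ≫ b = a' ≫ b' → act a (x j b hb hj) = act a' (x k' b' hb' hk') := by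
    intro m j k' a b _ hb hj a' b' c' hb' hk' hc hab
    have hbb : b' = (c' ≫ a) ≫ b := by
      rw [Category.assoc, hab, ← Category.assoc, hc, Category.id_comp]
    have ha : a' ≫ c' ≫ a = a := by
      rw [← cancel_mono b, Category.assoc, Category.assoc, hab, ← Category.assoc c', hc,
        Category.id_comp]
    subst hbb
    rw [hx _ _ (c' ≫ a) b hb hj hk', act_comp, ha]
  refine ⟨fun m σ h => act (ε σ h) (x _ (δ σ h) (hSδ σ h) (h₄ σ h)), ⟨?_, ?_⟩, ?_⟩
  · intro m' m ρ σ h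
    have := h₃ σ h
    rw [act_comp]
    refine (key _ _ this _ _ _ _ (γ _ (hS ρ σ h)) _ _ (h₂ _ _) ?_).symm
    rw [Category.assoc, h₁, h₁]
  · intro m σ h hm
    dsimp only
    rw [← hx _ _ (ε σ h) (δ σ h) (hSδ σ h) (h₄ σ h) hm]
    congr 1
    exact h₁ σ h
  · rintro y ⟨hy₁, hy₂⟩
    funext m σ h
    rw [← hy₂ _ (δ σ h) (hSδ σ h) (h₄ σ h), ← hy₁]
    congr 1
    exact (h₁ σ h).symm

end Factorization

/-! ### Boundary problems and natural fillers. -/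

section Fillers

variable {E : Type u} [Category.{v} E]

/-- A lifting problem, with parameters in `T`, of the boundary of the simplex `m` against `p`. -/
structure BoundaryProblem {P Q : SimplicialObject E} (p : P ⟶ Q) (m : SimplexCategory) (T : E) where
  /-- The simplex of the base. -/
  base : T ⟶ Q.obj (op m)
  /-- The boundary of the simplex to be constructed. -/
  face : ∀ (k : SimplexCategory) (σ : k ⟶ m), ¬ Epi σ → (T ⟶ P.obj (op k))
  face_comp : ∀ (k' k : SimplexCategory) (ρ : k' ⟶ k) (σ : k ⟶ m) (h : ¬ Epi σ)
    (h' : ¬ Epi (ρ ≫ σ)), face k' (ρ ≫ σ) h' = face k σ h ≫ P.map ρ.op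
  face_base : ∀ (k : SimplexCategory) (σ : k ⟶ m) (h : ¬ Epi σ),
    face k σ h ≫ p.app (op k) = base ≫ Q.map σ.op

/-- Change of parameters for boundary problems. -/
def BoundaryProblem.restrict {P Q : SimplicialObject E} {p : P ⟶ Q} {m : SimplexCategory} {T T' : E}
    (φ : BoundaryProblem p m T) (u : T' ⟶ T) : BoundaryProblem p m T' where
  base := u ≫ φ.base
  face k σ h := u ≫ φ.face k σ h
  face_comp k' k ρ σ h h' := by rw [φ.face_comp k' k ρ σ h h', Category.assoc]
  face_base k σ h := by rw [Category.assoc, Category.assoc, φ.face_base]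

lemma not_epi_comp {m' m n : SimplexCategory} (ρ : m' ⟶ m) {σ : m ⟶ n} (h : ¬ Epi σ) :
    ¬ Epi (ρ ≫ σ) :=
  fun _ => h (epi_of_epi ρ σ)

/-- Boundary problems are determined by their base and their values on the simplices of lower
dimension. -/
lemma BoundaryProblem.ext_of_len_lt {P Q : SimplicialObject E} {p : P ⟶ Q} {m : SimplexCategory}
    {T : E} {φ ψ : BoundaryProblem p m T} (h : φ.base = ψ.base)
    (h' : ∀ (k : SimplexCategory) (σ : k ⟶ m) (hσ : ¬ Epi σ), k.len < m.len →
      φ.face k σ hσ = ψ.face k σ hσ) : φ = ψ := by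
  obtain ⟨b, f, hf, hf'⟩ := φ
  obtain ⟨b', f', hf₁, hf₁'⟩ := ψ
  obtain rfl : b = b' := h
  obtain rfl : f = f' := by
    funext k σ hσ
    obtain ⟨j, ε, δ, γ, rfl, -, hδ, -, hj⟩ := exists_splitEpi_mono σ
    have hnδ : ¬ Epi δ := by
      intro hE
      have := (SimplexCategory.isIso_iff_of_mono δ).1
        (@isIso_of_mono_of_isSplitEpi _ _ _ _ δ _ (isSplitEpi_of_epi δ))
      exact absurd (hj hσ) (by lia)
    rw [hf _ _ ε δ hnδ hσ, hf₁ _ _ ε δ hnδ hσ]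
    congr 1
    exact h' _ δ hnδ (hj hσ)
  rfl

/-- An enriched lift against an inclusion of simplicial sets extends natural families of
morphisms, naturally in the parameters. -/
lemma HasEnrichedLift.exists_extension [CountablyLextensive E] {K : SSet.{0}} {S : K.Subcomplex}
    [∀ m, Countable (K.obj m)] [∀ m, Countable ((S : SSet.{0}).obj m)] {P Q : SimplicialObject E}
    {p : P ⟶ Q} (hp : HasEnrichedLift (fsetMap E S.ι) p) :
    ∃ L : ∀ (T : E) (α : ∀ j, (S : SSet.{0}).obj j → (T ⟶ P.obj j))
      (β : ∀ j, K.obj j → (T ⟶ Q.obj j)),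
      (∀ ⦃j j'⦄ (f : j ⟶ j') τ, α j τ ≫ P.map f = α j' ((S : SSet.{0}).map f τ)) →
      (∀ ⦃j j'⦄ (f : j ⟶ j') τ, β j τ ≫ Q.map f = β j' (K.map f τ)) →
      (∀ j τ, α j τ ≫ p.app j = β j τ.1) → ∀ j, K.obj j → (T ⟶ P.obj j),
      (∀ T α β hα hβ hαβ ⦃j j'⦄ (f : j ⟶ j') τ,
        L T α β hα hβ hαβ j τ ≫ P.map f = L T α β hα hβ hαβ j' (K.map f τ)) ∧
      (∀ T α β hα hβ hαβ j τ, L T α β hα hβ hαβ j τ ≫ p.app j = β j τ) ∧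
      (∀ T α β hα hβ hαβ j (τ : (S : SSet.{0}).obj j), L T α β hα hβ hαβ j τ.1 = α j τ) ∧
      ∀ ⦃T T' : E⦄ (u : T' ⟶ T) α β α' β' hα hβ hαβ hα' hβ' hαβ', (∀ j τ, α' j τ = u ≫ α j τ) →
        (∀ j τ, β' j τ = u ≫ β j τ) → ∀ j τ,
        L T' α' β' hα' hβ' hαβ' j τ = u ≫ L T α β hα hβ hαβ j τ := by
  obtain ⟨L, hL₁, hL₂, hL₃⟩ := hp.exists_lift
  have hab : ∀ (T : E) (α : ∀ j, (S : SSet.{0}).obj j → (T ⟶ P.obj j))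
      (β : ∀ j, K.obj j → (T ⟶ Q.obj j))
      (hα : ∀ ⦃j j'⦄ (f : j ⟶ j') τ, α j τ ≫ P.map f = α j' ((S : SSet.{0}).map f τ))
      (hβ : ∀ ⦃j j'⦄ (f : j ⟶ j') τ, β j τ ≫ Q.map f = β j' (K.map f τ))
      (_ : ∀ j τ, α j τ ≫ p.app j = β j τ.1),
      simplicialDesc α hα ≫ p = tensorMapRight T (fsetMap E S.ι) ≫ simplicialDesc β hβ := by
    intro T α β hα hβ hαβ
    apply tensor_fset_hom_ext
    intro j τ
    rw [NatTrans.comp_app, NatTrans.comp_app, ← Category.assoc, ← Category.assoc,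
      simplexPoint_simplicialDesc, simplexPoint_tensorMapRight, simplexPoint_simplicialDesc]
    exact hαβ j τ
  refine ⟨fun T α β hα hβ hαβ j τ =>
    simplexPoint T τ ≫ (L T _ _ (hab T α β hα hβ hαβ)).app j, ?_, ?_, ?_, ?_⟩
  · intro T α β hα hβ hαβ j j' f τ
    rw [Category.assoc, ← (L T _ _ (hab T α β hα hβ hαβ)).naturality, ← Category.assoc,
      simplexPoint_map]
  · intro T α β hα hβ hαβ j τ
    rw [Category.assoc, ← NatTrans.comp_app, hL₂, simplexPoint_simplicialDesc]
  · intro T α β hα hβ hαβ j τ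
    refine Eq.trans ?_ (simplexPoint_simplicialDesc α hα τ)
    conv_rhs => rw [← hL₁ T _ _ (hab T α β hα hβ hαβ)]
    rw [NatTrans.comp_app, ← Category.assoc, simplexPoint_tensorMapRight]
    rfl
  · intro T T' u α β α' β' hα hβ hαβ hα' hβ' hαβ' h hβu j τ
    beta_reduce
    rw [hL₃ u _ _ _ _ (hab T α β hα hβ hαβ) (hab T' α' β' hα' hβ' hαβ') ?_ ?_, NatTrans.comp_app,
      ← Category.assoc, simplexPoint_tensorMapLeft, Category.assoc]
    · apply tensor_fset_hom_ext
      intro j τ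
      rw [NatTrans.comp_app, ← Category.assoc, simplexPoint_tensorMapLeft, Category.assoc,
        simplexPoint_simplicialDesc, simplexPoint_simplicialDesc, h]
    · apply tensor_fset_hom_ext
      intro j τ
      rw [NatTrans.comp_app, ← Category.assoc, simplexPoint_tensorMapLeft, Category.assoc,
        simplexPoint_simplicialDesc, simplexPoint_simplicialDesc, hβu]

/-- Trivial fibrations have natural fillers of boundaries. -/
lemma exists_filler [CountablyLextensive E] {P Q : SimplicialObject E} {p : P ⟶ Q}
    (hp : enrichedFibrations (boundaryInclusions E) p) :
    ∃ L : ∀ (m : SimplexCategory) (T : E), BoundaryProblem p m T → (T ⟶ P.obj (op m)),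
      (∀ m T φ, L m T φ ≫ p.app (op m) = φ.base) ∧
      (∀ m T φ k (σ : k ⟶ m) h, L m T φ ≫ P.map σ.op = φ.face k σ h) ∧
      ∀ m ⦃T T' : E⦄ (u : T' ⟶ T) φ, L m T' (φ.restrict u) = u ≫ L m T φ := by
  have key : ∀ N : ℕ, ∃ L : ∀ (T : E), BoundaryProblem p ⦋N⦌ T → (T ⟶ P.obj (op ⦋N⦌)),
      (∀ T φ, L T φ ≫ p.app (op ⦋N⦌) = φ.base) ∧
      (∀ T φ k (σ : k ⟶ ⦋N⦌) h, L T φ ≫ P.map σ.op = φ.face k σ h) ∧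
      ∀ ⦃T T' : E⦄ (u : T' ⟶ T) φ, L T' (φ.restrict u) = u ≫ L T φ := by
    intro N
    obtain ⟨L, hL₁, hL₂, hL₃, hL₄⟩ :=
      HasEnrichedLift.exists_extension (hp _ (MorphismProperty.ofHoms.mk N))
    have hne : ∀ {j} (τ : (∂Δ[N] : SSet.{0}).obj j), ¬ Epi (SSet.stdSimplex.objEquiv τ.1) := by
      intro j τ hτ
      rw [SimplexCategory.epi_iff_surjective] at hτ
      exact τ.2 hτ
    have hmem : ∀ {k : SimplexCategory} (σ : k ⟶ ⦋N⦌), ¬ Epi σ →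
        SSet.stdSimplex.objEquiv.symm σ ∈ (∂Δ[N] : (Δ[N] : SSet.{0}).Subcomplex).obj (op k) := by
      intro k σ h hσ
      exact h (SimplexCategory.epi_iff_surjective.2 hσ)
    let α : ∀ T, BoundaryProblem p ⦋N⦌ T → ∀ j, (∂Δ[N] : SSet.{0}).obj j → (T ⟶ P.obj j) :=
      fun T φ j τ => φ.face j.unop (SSet.stdSimplex.objEquiv τ.1) (hne τ)
    let β : ∀ T, BoundaryProblem p ⦋N⦌ T → ∀ j, (Δ[N] : SSet.{0}).obj j → (T ⟶ Q.obj j) :=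
      fun T φ j τ => φ.base ≫ Q.map (SSet.stdSimplex.objEquiv τ).op
    have hα : ∀ T φ ⦃j j'⦄ (f : j ⟶ j') τ,
        α T φ j τ ≫ P.map f = α T φ j' ((∂Δ[N] : SSet.{0}).map f τ) := fun T φ j j' f τ =>
      (φ.face_comp _ _ f.unop (SSet.stdSimplex.objEquiv τ.1) (hne τ)
        (not_epi_comp _ (hne τ))).symm
    have hβ : ∀ T φ ⦃j j'⦄ (f : j ⟶ j') τ,
        β T φ j τ ≫ Q.map f = β T φ j' ((Δ[N] : SSet.{0}).map f τ) := by
      intro T φ j j' f τ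
      refine (Category.assoc _ _ _).trans ?_
      rw [← Q.map_comp]
      rfl
    have hαβ : ∀ T φ j τ, α T φ j τ ≫ p.app j = β T φ j τ.1 := fun T φ j τ => φ.face_base _ _ _
    refine ⟨fun T φ => L T (α T φ) (β T φ) (hα T φ) (hβ T φ) (hαβ T φ) (op ⦋N⦌)
      (SSet.stdSimplex.objEquiv.symm (𝟙 _)), ?_, ?_, ?_⟩
    · intro T φ
      rw [hL₂]
      exact (congrArg (φ.base ≫ ·) (Q.map_id _)).trans (Category.comp_id _)
    · intro T φ k σ h
      rw [hL₁]
      refine Eq.trans ?_ (hL₃ T (α T φ) (β T φ) (hα T φ) (hβ T φ) (hαβ T φ) (op k) ⟨_, hmem σ h⟩)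
      congr 1
      exact congrArg _ (Category.comp_id σ)
    · intro T T' u φ
      exact hL₄ u _ _ _ _ _ _ _ _ _ _ (fun j τ => rfl) (fun j τ => Category.assoc _ _ _) _ _
  choose L h₁ h₂ h₃ using key
  -- Every object `m` is definitionally `⦋m.len⦌`.
  exact ⟨fun m => L m.len, fun m => h₁ m.len, fun m => h₂ m.len, fun m => h₃ m.len⟩

end Fillers

/-! ### Degenerate simplices and partial lifts. -/

section Degenerate

variable {E : Type u} [Category.{v} E]

/-- The sieve of degenerate `m`-simplices of a simplicial object. -/
def degenerateSieve (X : SimplicialObject E) (m : SimplexCategory) : Sieve (X.obj (op m)) where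
  arrows T t := ∃ (k : SimplexCategory) (_ : k.len < m.len) (s : m ⟶ k) (t' : T ⟶ X.obj (op k)),
    t' ≫ X.map s.op = t
  downward_closed := by
    rintro _ _ _ ⟨k, hk, s, t', rfl⟩ u
    exact ⟨k, hk, s, u ≫ t', Category.assoc _ _ _⟩

/-- The simplicial set of `T`-points of a simplicial object. -/
def pointsSSet (X : SimplicialObject E) (T : E) : SSet.{v} :=
  X ⋙ coyoneda.obj (op T)

variable {X P Q : SimplicialObject E} {p : P ⟶ Q} {g : X ⟶ Q}

/-- The simplices of dimension less than `N` of a morphism `X ⟶ P` over `g`. -/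
structure PartialLift (p : P ⟶ Q) (g : X ⟶ Q) (N : ℕ) where
  /-- The components of the partial lift. -/
  app : ∀ m : SimplexCategory, m.len < N → (X.obj (op m) ⟶ P.obj (op m))
  naturality : ∀ (m m' : SimplexCategory) (h : m.len < N) (h' : m'.len < N) (σ : m ⟶ m'),
    X.map σ.op ≫ app m h = app m' h' ≫ P.map σ.op
  app_comp : ∀ (m : SimplexCategory) (h : m.len < N), app m h ≫ p.app (op m) = g.app (op m)

lemma PartialLift.ext {N : ℕ} {F F' : PartialLift p g N} (h : ∀ m hm, F.app m hm = F'.app m hm) :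
    F = F' := by
  obtain ⟨a, _, _⟩ := F
  obtain ⟨a', _, _⟩ := F'
  obtain rfl : a = a' := by
    funext m hm
    exact h m hm
  rfl

/-- The restriction of a partial lift. -/
def PartialLift.restrict {N N' : ℕ} (F : PartialLift p g N') (h : N ≤ N') : PartialLift p g N where
  app m hm := F.app m (hm.trans_le h)
  naturality m m' _ _ σ := F.naturality m m' _ _ σ
  app_comp m _ := F.app_comp m _

/-- The value of a partial lift on a simplex may be computed from its nondegenerate reduction. -/
lemma PartialLift.exists_nondegenerate {N : ℕ} (F : PartialLift p g N) {T : E}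
    {m k : SimplexCategory} (hk : k.len < N) (s : m ⟶ k) (t : T ⟶ X.obj (op k)) :
    ∃ (j : ℕ) (hj : j < N) (ε : m ⟶ ⦋j⦌) (_ : Epi ε) (y : (pointsSSet X T).nonDegenerate j),
      t ≫ X.map s.op = (pointsSSet X T).map ε.op y.1 ∧
      t ≫ F.app k hk ≫ P.map s.op = (show T ⟶ X.obj (op ⦋j⦌) from y.1) ≫
        F.app ⦋j⦌ hj ≫ P.map ε.op := by
  obtain ⟨l, ε, δ, γ, rfl, hγ, hδ, hl, -⟩ := exists_splitEpi_mono s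
  have hε : Epi ε := (SplitEpi.mk γ hγ).epi
  obtain ⟨j, ε', hε', y, hy⟩ := (pointsSSet X T).exists_nonDegenerate (n := l.len) (t ≫ X.map δ.op)
  have hj : j < N := ((SimplexCategory.len_le_of_epi ε').trans hl).trans_lt hk
  replace hy : t ≫ X.map δ.op = (show T ⟶ X.obj (op ⦋j⦌) from y.1) ≫ X.map ε'.op := hy
  have hl' : l.len < N := hl.trans_lt hk
  refine ⟨j, hj, ε ≫ ε', epi_comp _ _, y, ?_, ?_⟩
  · change _ = (show T ⟶ X.obj (op ⦋j⦌) from y.1) ≫ X.map (ε ≫ ε').op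
    rw [op_comp, X.map_comp, ← Category.assoc, hy, op_comp, X.map_comp, Category.assoc]
  · rw [op_comp, op_comp, P.map_comp, P.map_comp, ← Category.assoc (F.app k hk),
      ← F.naturality l k hl' hk δ, Category.assoc, ← Category.assoc t, hy, Category.assoc,
      ← Category.assoc (F.app ⦋j⦌ hj), ← F.naturality l _ hl' hj ε', Category.assoc]

/-- The Eilenberg–Zilber lemma in the simplicial set of `T`-points: both presentations reduce to the
same nondegenerate simplex and the same operator. Hence the value forced on a degenerate simplex is
well defined. -/
lemma PartialLift.app_eq_of_map_eq {N : ℕ} (F : PartialLift p g N) {T : E}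
    {m k k' : SimplexCategory} (hk : k.len < N) (hk' : k'.len < N) (s : m ⟶ k) (s' : m ⟶ k')
    (t : T ⟶ X.obj (op k)) (t' : T ⟶ X.obj (op k')) (h : t ≫ X.map s.op = t' ≫ X.map s'.op) :
    t ≫ F.app k hk ≫ P.map s.op = t' ≫ F.app k' hk' ≫ P.map s'.op := by
  obtain ⟨j, hj, ε, hε, y, h₁, h₂⟩ := F.exists_nondegenerate hk s t
  obtain ⟨j', hj', ε', hε', y', h₁', h₃⟩ := F.exists_nondegenerate hk' s' t'
  obtain rfl := (pointsSSet X T).unique_nonDegenerate_dim (n := m.len) (t ≫ X.map s.op) ε y h₁ ε' y'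
    (h.trans h₁')
  obtain rfl := (pointsSSet X T).unique_nonDegenerate_simplex (n := m.len) (t ≫ X.map s.op) ε y h₁
    ε' y' (h.trans h₁')
  obtain rfl := (pointsSSet X T).unique_nonDegenerate_map (n := m.len) (t ≫ X.map s.op) ε y h₁
    ε' y (h.trans h₁')
  rw [h₂, h₃]

/-- A partial lift determines boundary problems. -/
lemma PartialLift.exists_boundaryProblem {N : ℕ} (F : PartialLift p g N) {T : E}
    {m : SimplexCategory} (hm : m.len ≤ N) (t : T ⟶ X.obj (op m)) :
    ∃ φ : BoundaryProblem p m T, φ.base = t ≫ g.app (op m) ∧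
      ∀ (k : SimplexCategory) (σ : k ⟶ m) (hσ : ¬ Epi σ) (hk : k.len < N), k.len < m.len →
        φ.face k σ hσ = t ≫ X.map σ.op ≫ F.app k hk := by
  obtain ⟨y, ⟨hy₁, hy₂⟩, -⟩ := existsUnique_extension (W := fun k => (T ⟶ P.obj (op k)))
    (fun _ _ ρ x => x ≫ P.map ρ.op) (fun _ _ _ ρ' ρ x => by simp) (n := m)
    (fun k σ => ¬ Epi σ) (fun _ _ ρ σ h => not_epi_comp ρ h) (fun k => k.len < m.len)
    (fun k σ hσ => by
      obtain ⟨j, ε, δ, γ, h₁, h₂, h₃, -, h₄⟩ := exists_splitEpi_mono σ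
      exact ⟨j, ε, δ, γ, h₁, h₂, h₃, h₄ hσ⟩)
    (fun k σ _ hk => t ≫ X.map σ.op ≫ F.app k (hk.trans_le hm))
    (fun k' k ρ σ _ hk hk' => by
      rw [op_comp, X.map_comp, Category.assoc, Category.assoc, Category.assoc,
        F.naturality k' k (hk'.trans_le hm) (hk.trans_le hm) ρ])
  refine ⟨⟨t ≫ g.app (op m), y, fun k' k ρ σ h _ => hy₁ k' k ρ σ h, ?_⟩, rfl,
    fun k σ hσ _ hk => hy₂ k σ hσ hk⟩
  intro k σ hσ
  obtain ⟨j, ε, δ, γ, rfl, hγ, hδ, -, hj⟩ := exists_splitEpi_mono σ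
  have hnδ : ¬ Epi δ := by
    intro hE
    have : Epi ε := (SplitEpi.mk γ hγ).epi
    exact hσ (epi_comp _ _)
  rw [hy₁ _ _ ε δ hnδ, hy₂ _ δ hnδ (hj hσ), Category.assoc, p.naturality, Category.assoc,
    Category.assoc, ← Category.assoc (F.app _ _), F.app_comp, ← Category.assoc (X.map _),
    g.naturality, Category.assoc, ← Q.map_comp, Category.assoc]
  rfl

end Degenerate

/-! ### Extending lifts by induction on dimension. -/

section Extend

variable {E : Type u} [Category.{v} E] [FinitaryExtensive E]
variable {X P Q : SimplicialObject E} {p : P ⟶ Q} {g : X ⟶ Q}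

/-- A morphism in degree `m` is filled, relative to given components in lower degrees, if on
nondegenerate simplices it is the chosen filler of the boundary. -/
def IsFilled (L : ∀ (m : SimplexCategory) (T : E), BoundaryProblem p m T → (T ⟶ P.obj (op m)))
    (g : X ⟶ Q) (m : SimplexCategory)
    (f : ∀ k : SimplexCategory, k.len < m.len → (X.obj (op k) ⟶ P.obj (op k)))
    (w : X.obj (op m) ⟶ P.obj (op m)) : Prop :=
  ∀ ⦃T : E⦄ (t : T ⟶ X.obj (op m)), negSieve (degenerateSieve X m) t →
    ∀ φ : BoundaryProblem p m T, φ.base = t ≫ g.app (op m) →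
      (∀ (k : SimplexCategory) (σ : k ⟶ m) (hσ : ¬ Epi σ) (hk : k.len < m.len),
        φ.face k σ hσ = t ≫ X.map σ.op ≫ f k hk) → t ≫ w = L m T φ

variable (L : ∀ (m : SimplexCategory) (T : E), BoundaryProblem p m T → (T ⟶ P.obj (op m)))

/-- The degenerate and the nondegenerate simplices cover `X_m`. On the former naturality forces the
value, on the latter the filler does, and on overlaps there is nothing to compare. -/
lemma PartialLift.existsUnique_app {N : ℕ} (F : PartialLift p g N)
    (hL : ∀ m ⦃T T' : E⦄ (u : T' ⟶ T) φ, L m T' (φ.restrict u) = u ≫ L m T φ)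
    (m : SimplexCategory) (hm : m.len = N) (hX : Decides (degenerateSieve X m)) :
    ∃! w : X.obj (op m) ⟶ P.obj (op m),
      (∀ (k : SimplexCategory) (hk : k.len < N) (s : m ⟶ k),
        X.map s.op ≫ w = F.app k hk ≫ P.map s.op) ∧
      IsFilled L g m (fun k hk => F.app k (hk.trans_eq hm)) w := by
  subst hm
  -- Both requirements are imposed on all restrictions `u`, which makes `R` stable under change of
  -- parameters.
  let R : ∀ ⦃T : E⦄, (T ⟶ X.obj (op m)) → (T ⟶ P.obj (op m)) → Prop := fun T t w =>
    ∀ ⦃T' : E⦄ (u : T' ⟶ T),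
      (∀ (k : SimplexCategory) (hk : k.len < m.len) (s : m ⟶ k) (t' : T' ⟶ X.obj (op k)),
        t' ≫ X.map s.op = u ≫ t → u ≫ w = t' ≫ F.app k hk ≫ P.map s.op) ∧
      (negSieve (degenerateSieve X m) (u ≫ t) →
        ∀ φ : BoundaryProblem p m T', φ.base = (u ≫ t) ≫ g.app (op m) →
        (∀ (k : SimplexCategory) (σ : k ⟶ m) (hσ : ¬ Epi σ) (hk : k.len < m.len),
          φ.face k σ hσ = (u ≫ t) ≫ X.map σ.op ≫ F.app k hk) → u ≫ w = L m T' φ)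
  obtain ⟨w, hw, hwu⟩ := existsUnique_of_cover hX R
    (fun T T' u t w h T'' u' => by simpa using h (u' ≫ u)) (by
      rintro T t (⟨k, hk, s, t', rfl⟩ | ht)
      · refine ⟨t' ≫ F.app k hk ≫ P.map s.op, fun T' u => ⟨?_, ?_⟩, ?_⟩
        · intro k' hk' s' t'' h
          rw [← Category.assoc]
          exact F.app_eq_of_map_eq hk hk' s s' (u ≫ t') t'' (by rw [h, Category.assoc])
        · intro hneg φ _ _
          exact hom_ext_of_bot
            (bot_mem_of_neg (S := degenerateSieve X m) ⟨k, hk, s, u ≫ t', by simp⟩ hneg) _ _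
        · intro w hw
          simpa using (hw (𝟙 T)).1 k hk s t' (by simp)
      · obtain ⟨φ, hφ₁, hφ₂⟩ := F.exists_boundaryProblem le_rfl t
        refine ⟨L m T φ, fun T' u => ⟨?_, ?_⟩, ?_⟩
        · intro k hk s t' h
          exact hom_ext_of_bot (ht u ⟨k, hk, s, t', h⟩) _ _
        · intro _ ψ hψ₁ hψ₂
          rw [← hL]
          congr 1
          apply BoundaryProblem.ext_of_len_lt
          · rw [hψ₁, Category.assoc, ← hφ₁]
            rfl
          · intro k σ hσ hk
            rw [hψ₂ k σ hσ hk, Category.assoc, ← hφ₂ k σ hσ hk hk]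
            rfl
        · intro w hw
          simpa using (hw (𝟙 T)).2 (by simpa using ht) φ (by simpa using hφ₁)
            (fun k σ hσ hk => by simpa using hφ₂ k σ hσ hk hk))
  refine ⟨w, ⟨?_, ?_⟩, ?_⟩
  · intro k hk s
    have := (hw (X.map s.op) (Or.inl ⟨k, hk, s, 𝟙 _, by simp⟩) (𝟙 _)).1 k hk s (𝟙 _) (by simp)
    simpa using this
  · intro T t ht φ hφ₁ hφ₂
    simpa using (hw t (Or.inr ht) (𝟙 T)).2 (by simpa using ht) φ (by simpa using hφ₁)
      (fun k σ hσ hk => by simpa using hφ₂ k σ hσ hk)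
  · rintro w' ⟨h₁, h₂⟩
    refine hwu w' fun T t _ T' u => ⟨?_, ?_⟩
    · intro k hk s t' h
      rw [← Category.assoc, ← h, Category.assoc, h₁ k hk s]
    · intro hneg φ hφ₁ hφ₂
      rw [← Category.assoc]
      exact h₂ (u ≫ t) hneg φ hφ₁ hφ₂

/-- A partial lift is filled if all of its components are. -/
def PartialLift.Filled {N : ℕ} (F : PartialLift p g N) : Prop :=
  ∀ (m : SimplexCategory) (hm : m.len < N),
    IsFilled L g m (fun k hk => F.app k (hk.trans hm)) (F.app m hm)

lemma PartialLift.Filled.unique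
    (hL₃ : ∀ m ⦃T T' : E⦄ (u : T' ⟶ T) φ, L m T' (φ.restrict u) = u ≫ L m T φ)
    (hX : ∀ m, Decides (degenerateSieve X m)) {N : ℕ} {F F' : PartialLift p g N}
    (hF : F.Filled L) (hF' : F'.Filled L) : F = F' := by
  have key : ∀ (d : ℕ) (m : SimplexCategory) (hm : m.len < N), m.len = d →
      F.app m hm = F'.app m hm := by
    intro d
    induction d using Nat.strong_induction_on with
    | _ d ih =>
      rintro m hm rfl
      refine ((F.restrict hm.le).existsUnique_app L hL₃ m rfl (hX m)).unique
        ⟨fun k hk s => F.naturality m k hm (hk.trans hm) s, hF m hm⟩ ⟨fun k hk s => ?_, ?_⟩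
      · rw [F'.naturality m k hm (hk.trans hm) s, ← ih k.len hk k (hk.trans hm) rfl]
        rfl
      · intro T t ht φ h₁ h₂
        refine hF' m hm t ht φ h₁ fun k σ hσ hk => ?_
        rw [h₂ k σ hσ hk]
        exact congrArg (fun f => t ≫ X.map σ.op ≫ f) (ih k.len hk k (hk.trans hm) rfl)
  exact PartialLift.ext fun m hm => key m.len m hm rfl

/-- The new component in dimension `N` is the unique filled one; its naturality and its
compatibility with `p` are checked on the cover by degenerate and nondegenerate simplices. -/
lemma PartialLift.Filled.exists_succ (hL₁ : ∀ m T φ, L m T φ ≫ p.app (op m) = φ.base)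
    (hL₂ : ∀ m T φ k (σ : k ⟶ m) h, L m T φ ≫ P.map σ.op = φ.face k σ h)
    (hL₃ : ∀ m ⦃T T' : E⦄ (u : T' ⟶ T) φ, L m T' (φ.restrict u) = u ≫ L m T φ)
    (hX : ∀ m, Decides (degenerateSieve X m)) {N : ℕ} {F : PartialLift p g N}
    (hF : F.Filled L) : ∃ F' : PartialLift p g (N + 1), F'.Filled L := by
  choose w hw _ using fun m hm => F.existsUnique_app L hL₃ m hm (hX m)
  have hdown : ∀ (k m : SimplexCategory) (hk : k.len < N) (hm : m.len = N) (σ : k ⟶ m),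
      X.map σ.op ≫ F.app k hk = w m hm ≫ P.map σ.op := by
    intro k m hk hm σ
    refine hom_ext_of_cover (hX m) ?_
    rintro T t (⟨j, hj, s, t', rfl⟩ | ht)
    · have hj' : j.len < N := hj.trans_eq hm
      rw [Category.assoc, Category.assoc, ← Category.assoc (X.map s.op) (w m hm),
        (hw m hm).1 j hj' s, ← Category.assoc (X.map s.op), ← X.map_comp, ← op_comp,
        F.naturality k j hk hj' (σ ≫ s), Category.assoc, ← P.map_comp, ← op_comp]
    · obtain ⟨φ, hφ₁, hφ₂⟩ := F.exists_boundaryProblem hm.le t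
      have hσ : ¬ Epi σ := fun _ => by
        have := SimplexCategory.len_le_of_epi σ
        lia
      rw [← Category.assoc t (w m hm), (hw m hm).2 t ht φ hφ₁
        (fun k σ hσ hk => hφ₂ k σ hσ (hk.trans_eq hm) hk), hL₂ m T φ k σ hσ,
        hφ₂ k σ hσ hk (by lia)]
  have hsame : ∀ (m m' : SimplexCategory) (hm : m.len = N) (hm' : m'.len = N) (σ : m ⟶ m'),
      X.map σ.op ≫ w m hm = w m' hm' ≫ P.map σ.op := by
    intro m m' hm hm' σ
    obtain rfl : m = m' := SimplexCategory.ext (hm.trans hm'.symm)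
    -- An endomorphism of `[N]` is the identity or factors through a lower dimension.
    by_cases hσ : Epi σ
    · obtain rfl := SimplexCategory.eq_id_of_epi σ
      simp
    · obtain ⟨k, ε, δ, -, rfl, -, -, -, hk⟩ := exists_splitEpi_mono σ
      have hk' : k.len < N := (hk hσ).trans_eq hm
      rw [op_comp, X.map_comp, Category.assoc, (hw m hm).1 k hk' ε, ← Category.assoc,
        hdown k m hk' hm δ, Category.assoc, ← P.map_comp]
  have hover : ∀ (m : SimplexCategory) (hm : m.len = N),
      w m hm ≫ p.app (op m) = g.app (op m) := by
    intro m hm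
    refine hom_ext_of_cover (hX m) ?_
    rintro T t (⟨j, hj, s, t', rfl⟩ | ht)
    · have hj' : j.len < N := hj.trans_eq hm
      rw [Category.assoc, Category.assoc, ← Category.assoc (X.map s.op) (w m hm),
        (hw m hm).1 j hj' s, Category.assoc, p.naturality, ← Category.assoc (F.app j hj'),
        F.app_comp, g.naturality]
    · obtain ⟨φ, hφ₁, hφ₂⟩ := F.exists_boundaryProblem hm.le t
      rw [← Category.assoc t (w m hm), (hw m hm).2 t ht φ hφ₁
        (fun k σ hσ hk => hφ₂ k σ hσ (hk.trans_eq hm) hk), hL₁, hφ₁]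
  let app : ∀ m : SimplexCategory, m.len < N + 1 → (X.obj (op m) ⟶ P.obj (op m)) := fun m hm =>
    if h : m.len < N then F.app m h else w m (by lia)
  have happ : ∀ m hm (h : m.len < N), app m hm = F.app m h := fun m hm h => dif_pos h
  have happ' : ∀ m hm (h : m.len = N), app m hm = w m h := fun m hm h => dif_neg (by lia)
  refine ⟨⟨app, ?_, ?_⟩, ?_⟩
  · intro m m' hm hm' σ
    rcases Nat.lt_succ_iff_lt_or_eq.1 hm with h | h <;>
    rcases Nat.lt_succ_iff_lt_or_eq.1 hm' with h' | h'
    · rw [happ m hm h, happ m' hm' h', F.naturality]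
    · rw [happ m hm h, happ' m' hm' h', hdown]
    · rw [happ' m hm h, happ m' hm' h', (hw m h).1]
    · rw [happ' m hm h, happ' m' hm' h', hsame]
  · intro m hm
    rcases Nat.lt_succ_iff_lt_or_eq.1 hm with h | h
    · rw [happ m hm h, F.app_comp]
    · rw [happ' m hm h, hover]
  · intro m hm T t ht φ h₁ h₂
    rcases Nat.lt_succ_iff_lt_or_eq.1 hm with h | h
    · refine Eq.trans ?_ (hF m h t ht φ h₁ fun k σ hσ hk => ?_)
      · exact congrArg (t ≫ ·) (happ m hm h)
      · rw [h₂ k σ hσ hk]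
        exact congrArg (fun f => t ≫ X.map σ.op ≫ f) (happ k (hk.trans hm) (hk.trans h))
    · refine Eq.trans ?_ ((hw m h).2 t ht φ h₁ fun k σ hσ hk => ?_)
      · exact congrArg (t ≫ ·) (happ' m hm h)
      · rw [h₂ k σ hσ hk]
        exact congrArg (fun f => t ≫ X.map σ.op ≫ f) (happ k (hk.trans hm) (hk.trans_eq h))

/-- If the degenerate simplices of `X` are decidable, then a morphism to the base of a map with
natural fillers has a unique lift which is filled. -/
lemma existsUnique_filled (hL₁ : ∀ m T φ, L m T φ ≫ p.app (op m) = φ.base)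
    (hL₂ : ∀ m T φ k (σ : k ⟶ m) h, L m T φ ≫ P.map σ.op = φ.face k σ h)
    (hL₃ : ∀ m ⦃T T' : E⦄ (u : T' ⟶ T) φ, L m T' (φ.restrict u) = u ≫ L m T φ)
    (hX : ∀ m, Decides (degenerateSieve X m)) :
    ∃! l : X ⟶ P, l ≫ p = g ∧
      ∀ m, IsFilled L g m (fun k _ => l.app (op k)) (l.app (op m)) := by
  have hex : ∀ N, ∃ F : PartialLift p g N, F.Filled L := by
    intro N
    induction N with
    | zero =>
      exact ⟨⟨fun m hm => absurd hm (Nat.not_lt_zero _), fun m _ hm => absurd hm (Nat.not_lt_zero _),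
        fun m hm => absurd hm (Nat.not_lt_zero _)⟩, fun m hm => absurd hm (Nat.not_lt_zero _)⟩
    | succ N ih =>
      obtain ⟨F, hF⟩ := ih
      exact hF.exists_succ L hL₁ hL₂ hL₃ hX
  choose F hF using hex
  -- The partial lifts were chosen separately for each `N`, but uniqueness of filled ones makes them
  -- agree.
  have hFF : ∀ (N N' : ℕ) (m : SimplexCategory) (hm : m.len < N) (hm' : m.len < N'),
      (F N).app m hm = (F N').app m hm' := by
    have : ∀ (N N' : ℕ) (h : N ≤ N'), F N = (F N').restrict h := fun N N' h =>
      PartialLift.Filled.unique L hL₃ hX (hF N)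
        (fun m hm => hF N' m (hm.trans_le h))
    intro N N' m hm hm'
    rcases le_total N N' with h | h
    · rw [this N N' h]
      rfl
    · rw [this N' N h]
      rfl
  let l : X ⟶ P :=
    { app := fun m => (F (m.unop.len + 1)).app m.unop (Nat.lt_succ_self _)
      naturality := fun m m' f => by
        let N := max (m.unop.len + 1) (m'.unop.len + 1)
        have hm : m.unop.len < N := lt_of_lt_of_le (Nat.lt_succ_self _) (le_max_left _ _)
        have hm' : m'.unop.len < N := lt_of_lt_of_le (Nat.lt_succ_self _) (le_max_right _ _)
        rw [hFF _ N m.unop _ hm, hFF _ N m'.unop _ hm']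
        exact (F N).naturality m'.unop m.unop hm' hm f.unop }
  refine ⟨l, ⟨?_, ?_⟩, ?_⟩
  · ext m
    exact (F (m.unop.len + 1)).app_comp m.unop _
  · intro m T t ht φ h₁ h₂
    refine hF (m.len + 1) m (Nat.lt_succ_self _) t ht φ h₁ fun k σ hσ hk => ?_
    rw [h₂ k σ hσ hk]
    exact congrArg (fun f => t ≫ X.map σ.op ≫ f) (hFF _ _ k _ _)
  · rintro l' ⟨hl₁, hl₂⟩
    let F' : ∀ N, PartialLift p g N := fun N =>
      { app := fun m _ => l'.app (op m)
        naturality := fun m m' _ _ σ => l'.naturality σ.op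
        app_comp := fun m _ => by rw [← NatTrans.comp_app, hl₁] }
    ext m
    have : F' (m.unop.len + 1) = F (m.unop.len + 1) :=
      PartialLift.Filled.unique L hL₃ hX (fun k _ => hl₂ k) (hF _)
    exact congrArg (fun G : PartialLift p g (m.unop.len + 1) =>
      G.app m.unop (Nat.lt_succ_self _)) this

end Extend

/-! ### Decidable degeneracy implies cofibrancy. -/

section Cofibrant

variable {E : Type u} [Category.{v} E] [CountablyLextensive E]

/-- Operators act trivially on the factor `e`. So decidability of degenerate simplices passes to `e
× X`, as enriched lifting requires. -/
lemma degenerateSieve_tensor (e : E) (X : SimplicialObject E) (m : SimplexCategory) :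
    degenerateSieve (tensor e X) m =
      (degenerateSieve X m).pullback ((tensorSnd e X).app (op m)) := by
  ext T t
  constructor
  · rintro ⟨k, hk, s, t', rfl⟩
    refine ⟨k, hk, s, t' ≫ (tensorSnd e X).app (op k), ?_⟩
    rw [Category.assoc, Category.assoc, (tensorSnd e X).naturality]
  · rintro ⟨k, hk, s, t', ht'⟩
    let t₁ : T ⟶ e ⨯ X.obj (op m) := t
    let t₂ : T ⟶ e ⨯ X.obj (op k) := prod.lift (t₁ ≫ prod.fst) t'
    refine ⟨k, hk, s, t₂, ?_⟩
    change t₂ ≫ prod.map (𝟙 e) (X.map s.op) = t₁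
    apply Limits.prod.hom_ext
    · rw [Category.assoc, prod.map_fst, Category.comp_id]
      exact prod.lift_fst _ _
    · rw [Category.assoc, prod.map_snd, ← Category.assoc]
      exact (congrArg (· ≫ X.map s.op) (prod.lift_snd _ _)).trans ht'

/-- A simplicial object is cofibrant if its degenerate simplices are decidable. -/
lemma cofibrant_of_decides {X : SimplicialObject E} (hX : ∀ m, Decides (degenerateSieve X m)) :
    Cofibrant X := by
  intro P Q p hp
  obtain ⟨L, hL₁, hL₂, hL₃⟩ := exists_filler hp
  refine hasEnrichedLift_of_existsUnique _ p
    (fun e l => ∀ m, IsFilled L (l ≫ p) m (fun k _ => l.app (op k)) (l.app (op m))) ?_ ?_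
  · intro e e' u l hl m T t ht φ h₁ h₂
    rw [NatTrans.comp_app, ← Category.assoc]
    refine hl m _ ?_ φ ?_ ?_
    · rw [degenerateSieve_tensor, negSieve_pullback] at ht ⊢
      have : t ≫ (tensorSnd e' X).app (op m) =
          (t ≫ (tensorMapLeft u X).app (op m)) ≫ (tensorSnd e X).app (op m) := by
        rw [Category.assoc]
        congr 1
        exact ((prod.map_snd u (𝟙 (X.obj (op m)))).trans (Category.comp_id _)).symm
      rw [Sieve.pullback_apply] at ht ⊢
      rw [← this]
      exact ht
    · rw [h₁]
      simp only [NatTrans.comp_app, Category.assoc]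
    · intro k σ hσ hk
      rw [h₂ k σ hσ hk]
      beta_reduce
      rw [NatTrans.comp_app, Category.assoc,
        ← Category.assoc ((tensorMapLeft u X).app (op m)), ← (tensorMapLeft u X).naturality,
        Category.assoc]
  · intro e a b hab
    have hdec : ∀ m, Decides (degenerateSieve (tensor e X) m) := by
      intro m
      rw [degenerateSieve_tensor]
      exact (hX m).pullback _
    obtain ⟨l, ⟨hl₁, hl₂⟩, hlu⟩ := existsUnique_filled (g := b) L hL₁ hL₂ hL₃ hdec
    refine ⟨l, ⟨?_, hl₁, ?_⟩, ?_⟩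
    -- `e × ∅` maps to the initial object in each degree, so the condition on the source is
    -- automatic.
    · ext j
      refine hom_ext_of_bot (bot_mem_of_hom (bot_mem_of_isInitial ?_)
        ((tensorSnd e (⊥_ (SimplicialObject E))).app j)) _ _
      exact IsInitial.isInitialObj ((evaluation SimplexCategoryᵒᵖ E).obj j) _
        (initialIsInitial (C := SimplicialObject E))
    · rw [hl₁]
      exact hl₂
    · rintro l' ⟨-, h₂, h₃⟩
      refine hlu l' ⟨h₂, ?_⟩
      rw [h₂] at h₃
      exact h₃

end Cofibrant

/-! ### Pushforward along a single coproduct inclusion. -/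

section Level

variable {E : Type u} [Category.{v} E] [FinitaryExtensive E]

lemma exists_hom_of_bot {T W : E} (h : ⊥ ∈ extensiveTopology E T) : Nonempty (T ⟶ W) := by
  obtain ⟨w, -, -⟩ := existsUnique_of_cover h (W := W) (fun _ _ _ => True)
    (fun _ _ _ _ _ _ => trivial) (fun _ _ ht => ht.elim)
  exact ⟨w⟩

/-- The pushforward of an object along a coproduct inclusion. -/
lemma exists_pushforward_of_isColimit {A B C X : E} {i : A ⟶ B} {c : C ⟶ B}
    (hc : IsColimit (BinaryCofan.mk i c)) (q : X ⟶ A) :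
    ∃ (Y : E) (β : Y ⟶ B) (ι : X ⟶ Y) (κ : C ⟶ Y), Mono ι ∧
      Nonempty (IsColimit (BinaryCofan.mk ι κ)) ∧ ι ≫ β = q ≫ i ∧
      (∀ ⦃T : E⦄ (y : T ⟶ Y) (a : T ⟶ A), a ≫ i = y ≫ β → ∃ x, x ≫ ι = y) ∧
      ∀ ⦃T : E⦄ (b : T ⟶ B) (val : ∀ ⦃T' : E⦄ (u : T' ⟶ T) (a : T' ⟶ A), a ≫ i = u ≫ b → (T' ⟶ X)),
        (∀ ⦃T' : E⦄ (u : T' ⟶ T) (a : T' ⟶ A) (h : a ≫ i = u ≫ b), val u a h ≫ q = a) →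
        (∀ ⦃T' T'' : E⦄ (u' : T'' ⟶ T') (u : T' ⟶ T) (a : T' ⟶ A) (h : a ≫ i = u ≫ b)
          (h' : (u' ≫ a) ≫ i = (u' ≫ u) ≫ b), val (u' ≫ u) (u' ≫ a) h' = u' ≫ val u a h) →
        ∃! y : T ⟶ Y, y ≫ β = b ∧ ∀ ⦃T' : E⦄ (u : T' ⟶ T) (a : T' ⟶ A) (h : a ≫ i = u ≫ b),
          val u a h ≫ ι = u ≫ y := by
  have hY := coprodIsCoprod X C
  have hmι : Mono (coprod.inl : X ⟶ X ⨿ C) :=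
    FinitaryExtensive.mono_inl_of_isColimit (c := BinaryCofan.mk coprod.inl coprod.inr) hY
  have hmc : Mono c := FinitaryExtensive.mono_inr_of_isColimit hc
  have hmi : Mono i := FinitaryExtensive.mono_inl_of_isColimit hc
  -- Over `A` a family is an element of `X`; over the complement `C` it is indexed by nothing, so
  -- there is exactly one.
  refine ⟨X ⨿ C, coprod.desc (q ≫ i) c, coprod.inl, coprod.inr, hmι, ⟨hY⟩, coprod.inl_desc _ _,
    ?_, ?_⟩
  · intro T y a h
    refine Represented.of_cover (S := factorSieve coprod.inl) ⟨X, _, hmι, rfl⟩ y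
      ((extensiveTopology E).pullback_stable y (sup_factorSieve_mem hY)) ?_
    rintro T' u (hu | ⟨k, hk⟩)
    · exact hu
    · have hbot : ⊥ ∈ extensiveTopology E T' := bot_mem_of_factors hc (u ≫ a) k (by
        rw [Category.assoc, h, ← Category.assoc, ← hk, Category.assoc, coprod.inr_desc])
      obtain ⟨x⟩ := exists_hom_of_bot (W := X) hbot
      exact ⟨x, hom_ext_of_bot hbot _ _⟩
  · intro T b val hval₁ hval₂
    obtain ⟨y, hy, hyu⟩ := existsUnique_of_cover (W := X ⨿ C)
      ((extensiveTopology E).pullback_stable b (sup_factorSieve_mem hc))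
      (fun T' t w => w ≫ coprod.desc (q ≫ i) c = t ≫ b ∧
        ∀ ⦃T'' : E⦄ (u : T'' ⟶ T') (a : T'' ⟶ A) (h : a ≫ i = (u ≫ t) ≫ b),
          val (u ≫ t) a h ≫ coprod.inl = u ≫ w)
      (by
        rintro T' T'' u t w ⟨h₁, h₂⟩
        refine ⟨by rw [Category.assoc, h₁, Category.assoc], fun T₃ u' a h => ?_⟩
        have := h₂ (u' ≫ u) a (by simpa using h)
        simpa using this)
      (by
        rintro T' t (⟨a, ha⟩ | ⟨k, hk⟩)
        · refine ⟨val t a ha ≫ coprod.inl, ⟨?_, fun T'' u a' h => ?_⟩, ?_⟩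
          · rw [Category.assoc, coprod.inl_desc, ← Category.assoc, hval₁, ha]
          · obtain rfl : a' = u ≫ a := by
              rw [← cancel_mono i, h, Category.assoc, Category.assoc, ha]
            rw [hval₂ u t a ha, Category.assoc]
          · rintro w ⟨-, hw⟩
            have := hw (𝟙 _) a (by simpa using ha)
            simpa using this.symm
        · refine ⟨k ≫ coprod.inr, ⟨?_, fun T'' u a' h => ?_⟩, ?_⟩
          · rw [Category.assoc, coprod.inr_desc, hk]
          · refine hom_ext_of_bot (bot_mem_of_factors hc a' (u ≫ k) ?_) _ _
            rw [h, Category.assoc, Category.assoc, hk]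
          -- Over `C`, a lift cannot meet the summand `X`, which lies over `A`; in the summand `C`
          -- it is determined because `c` is monic.
          · rintro w ⟨hw, -⟩
            refine hom_ext_of_cover
              ((extensiveTopology E).pullback_stable w (sup_factorSieve_mem hY)) ?_
            rintro T'' u (⟨x, hx⟩ | ⟨k', hk'⟩)
            · refine hom_ext_of_bot (bot_mem_of_factors hc (x ≫ q) (u ≫ k) ?_) _ _
              rw [Category.assoc, Category.assoc, hk, ← hw, ← Category.assoc u, ← hx, Category.assoc,
                coprod.inl_desc]
            · have : k' = u ≫ k := by
                rw [← cancel_mono c, Category.assoc, hk, ← hw, ← Category.assoc, ← hk',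
                  Category.assoc, coprod.inr_desc]
              rw [← hk', this, Category.assoc])
    have hcov := (extensiveTopology E).pullback_stable b (sup_factorSieve_mem hc)
    refine ⟨y, ⟨hom_ext_of_cover hcov fun T' t ht => ?_, fun T' u a h => ?_⟩, ?_⟩
    · rw [← Category.assoc]
      exact (hy t ht).1
    · have := (hy u (Or.inl ⟨a, h⟩)).2 (𝟙 _) a (by simpa using h)
      simpa using this
    · rintro y' ⟨rfl, hy'⟩
      refine hyu y' fun T' t _ => ⟨Category.assoc _ _ _, fun T'' u a h => ?_⟩
      rw [hy', Category.assoc]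

/-- A conditional equation between morphisms, whose condition is the factorization through a
coproduct inclusion, is equivalent to an equation. -/
lemma exists_conditional {X C Y V Z : E} {ι : X ⟶ Y} {κ : C ⟶ Y}
    (h : IsColimit (BinaryCofan.mk ι κ)) (y : V ⟶ Y) (z : V ⟶ Z) (r : X ⟶ Z) :
    ∃ e : V ⟶ Z, ∀ ⦃T : E⦄ (t : T ⟶ V), t ≫ e = t ≫ z ↔
      ∀ ⦃T' : E⦄ (u : T' ⟶ T) (x : T' ⟶ X), x ≫ ι = u ≫ t ≫ y → x ≫ r = u ≫ t ≫ z := by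
  have hmι : Mono ι := FinitaryExtensive.mono_inl_of_isColimit h
  have hcov := (extensiveTopology E).pullback_stable y (sup_factorSieve_mem h)
  -- `e` is `r` where `y` lies in `X`, and is `z` elsewhere, so that off `X` the equation with `z`
  -- holds trivially.
  obtain ⟨e, he, -⟩ := existsUnique_of_cover hcov (W := Z)
    (fun T t w => ∀ ⦃T' : E⦄ (u : T' ⟶ T),
      (∀ x : T' ⟶ X, x ≫ ι = u ≫ t ≫ y → u ≫ w = x ≫ r) ∧
      ∀ k : T' ⟶ C, k ≫ κ = u ≫ t ≫ y → u ≫ w = u ≫ t ≫ z)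
    (fun T T' u t w hw T'' u' => by simpa using hw (u' ≫ u))
    (by
      rintro T t (⟨x, hx⟩ | ⟨k, hk⟩)
      · refine ⟨x ≫ r, fun T' u => ⟨fun x' hx' => ?_, fun k hk => ?_⟩, fun w hw => ?_⟩
        · obtain rfl : x' = u ≫ x := by rw [← cancel_mono ι, hx', Category.assoc, hx]
          rw [Category.assoc]
        · exact hom_ext_of_bot (bot_mem_of_factors h (u ≫ x) k (by rw [Category.assoc, hx, hk])) _ _
        · simpa using (hw (𝟙 T)).1 x (by simpa using hx)
      · refine ⟨t ≫ z, fun T' u => ⟨fun x' hx' => ?_, fun k hk => rfl⟩, fun w hw => ?_⟩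
        · exact hom_ext_of_bot
            (bot_mem_of_factors h x' (u ≫ k) (by rw [Category.assoc, hk, hx'])) _ _
        · simpa using (hw (𝟙 T)).2 k (by simpa using hk))
  have he₁ : ∀ ⦃T : E⦄ (t : T ⟶ V) (x : T ⟶ X), x ≫ ι = t ≫ y → t ≫ e = x ≫ r := by
    intro T t x hx
    have := (he t (Or.inl ⟨x, hx⟩) (𝟙 T)).1 x (by simpa using hx)
    simpa using this
  refine ⟨e, fun T t => ⟨fun ht T' u x hx => ?_, fun ht => ?_⟩⟩
  · rw [← ht, ← Category.assoc, he₁ (u ≫ t) x (by simpa using hx)]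
  · refine hom_ext_of_cover ((extensiveTopology E).pullback_stable t hcov) ?_
    rintro T' u (⟨x, hx⟩ | ⟨k, hk⟩)
    · rw [← Category.assoc, he₁ (u ≫ t) x hx]
      exact ht u x (by simpa using hx)
    · have := (he (u ≫ t) (Or.inr ⟨k, hk⟩) (𝟙 T')).2 k (by simpa using hk)
      simpa using this

end Level

/-! ### Finite systems of equations. -/

section Represent

variable {E : Type u} [Category.{v} E] [HasFiniteLimits E]

/-- Solutions of finite systems of equations between morphisms out of `B × ∏ Y` are
representable. -/
lemma exists_solutionObject {I J : Type} [Finite I] [Finite J] (B : E) (Y : I → E) (Z : J → E)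
    (f g : ∀ j, (B ⨯ ∏ᶜ Y) ⟶ Z j) :
    ∃ (S : E) (π : S ⟶ B) (η : ∀ σ, S ⟶ Y σ),
      (∀ j, prod.lift π (Pi.lift η) ≫ f j = prod.lift π (Pi.lift η) ≫ g j) ∧
      ∀ ⦃T : E⦄ (b : T ⟶ B) (y : ∀ σ, T ⟶ Y σ),
        (∀ j, prod.lift b (Pi.lift y) ≫ f j = prod.lift b (Pi.lift y) ≫ g j) →
        ∃! t : T ⟶ S, t ≫ π = b ∧ ∀ σ, t ≫ η σ = y σ := by
  let e := equalizer.ι (Pi.lift f) (Pi.lift g)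
  have he : prod.lift (e ≫ prod.fst) (Pi.lift fun σ => e ≫ prod.snd ≫ Pi.π Y σ) = e := by
    apply Limits.prod.hom_ext
    · rw [prod.lift_fst]
    · rw [prod.lift_snd]
      apply Pi.hom_ext
      intro σ
      rw [Pi.lift_π, Category.assoc]
  refine ⟨equalizer (Pi.lift f) (Pi.lift g), e ≫ prod.fst, fun σ => e ≫ prod.snd ≫ Pi.π Y σ, ?_, ?_⟩
  · intro j
    rw [he]
    have := equalizer.condition (Pi.lift f) (Pi.lift g) =≫ Pi.π Z j
    simpa only [Category.assoc, Pi.lift_π] using this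
  · intro T b y h
    have h' : prod.lift b (Pi.lift y) ≫ Pi.lift f = prod.lift b (Pi.lift y) ≫ Pi.lift g := by
      apply Pi.hom_ext
      intro j
      simpa only [Category.assoc, Pi.lift_π] using h j
    refine ⟨equalizer.lift _ h', ⟨?_, fun σ => ?_⟩, ?_⟩
    · rw [← Category.assoc, equalizer.lift_ι, prod.lift_fst]
    · rw [← Category.assoc, equalizer.lift_ι, ← Category.assoc, prod.lift_snd, Pi.lift_π]
    · rintro t ⟨ht₁, ht₂⟩
      apply equalizer.hom_ext
      rw [equalizer.lift_ι]
      apply Limits.prod.hom_ext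
      · rw [prod.lift_fst, Category.assoc]
        exact ht₁
      · rw [prod.lift_snd]
        apply Pi.hom_ext
        intro σ
        rw [Pi.lift_π, ← ht₂ σ]
        simp only [Category.assoc, e]

end Represent

/-! ### Families over the faces in `A`, and their representability. -/

section Families

variable {E : Type u} [Category.{v} E] {A B X : SimplicialObject E}

/-- The elements of the pushforward of `q : X ⟶ A` along `i : A ⟶ B`: a simplex `base` of `B`, with a
natural family of simplices of `X` indexed by the faces of `base` in `A`. -/
structure PushFamily (i : A ⟶ B) (q : X ⟶ A) (n : SimplexCategory) (T : E) where
  /-- The underlying simplex of the base. -/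
  base : T ⟶ B.obj (op n)
  /-- The simplex of `X` attached to a face of the base in `A`. -/
  val : ∀ ⦃T' : E⦄ (u : T' ⟶ T) ⦃m : SimplexCategory⦄ (σ : m ⟶ n) (a : T' ⟶ A.obj (op m)),
    a ≫ i.app (op m) = u ≫ base ≫ B.map σ.op → (T' ⟶ X.obj (op m))
  val_comp_app : ∀ ⦃T' : E⦄ (u : T' ⟶ T) ⦃m : SimplexCategory⦄ (σ : m ⟶ n)
    (a : T' ⟶ A.obj (op m)) (h : a ≫ i.app (op m) = u ≫ base ≫ B.map σ.op),
    val u σ a h ≫ q.app (op m) = a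
  val_comp : ∀ ⦃T' T'' : E⦄ (u' : T'' ⟶ T') (u : T' ⟶ T) ⦃m m' : SimplexCategory⦄ (ρ : m' ⟶ m)
    (σ : m ⟶ n) (a : T' ⟶ A.obj (op m)) (h : a ≫ i.app (op m) = u ≫ base ≫ B.map σ.op)
    (h' : (u' ≫ a ≫ A.map ρ.op) ≫ i.app (op m') = (u' ≫ u) ≫ base ≫ B.map (ρ ≫ σ).op),
    val (u' ≫ u) (ρ ≫ σ) (u' ≫ a ≫ A.map ρ.op) h' = u' ≫ val u σ a h ≫ X.map ρ.op

namespace PushFamily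

variable {i : A ⟶ B} {q : X ⟶ A} {n : SimplexCategory} {T : E}

lemma comp_map_app {T' T'' : E} {b : T ⟶ B.obj (op n)} (u' : T'' ⟶ T') (u : T' ⟶ T)
    {m m' : SimplexCategory} (ρ : m' ⟶ m) (σ : m ⟶ n) (a : T' ⟶ A.obj (op m))
    (h : a ≫ i.app (op m) = u ≫ b ≫ B.map σ.op) :
    (u' ≫ a ≫ A.map ρ.op) ≫ i.app (op m') = (u' ≫ u) ≫ b ≫ B.map (ρ ≫ σ).op := by
  rw [op_comp, B.map_comp, Category.assoc, Category.assoc, i.naturality, ← Category.assoc a, h]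
  simp only [Category.assoc]

lemma val_congr (F : PushFamily i q n T) {T' : E} {u u' : T' ⟶ T} {m : SimplexCategory}
    {σ σ' : m ⟶ n} {a a' : T' ⟶ A.obj (op m)} (hu : u = u') (hσ : σ = σ') (ha : a = a') (h) (h') :
    F.val u σ a h = F.val u' σ' a' h' := by
  subst hu hσ ha
  rfl

lemma val_eq_of_eq {F F' : PushFamily i q n T} (e : F = F') {T' : E} (u : T' ⟶ T)
    {m : SimplexCategory} (σ : m ⟶ n) (a : T' ⟶ A.obj (op m)) (h) (h') :
    F.val u σ a h = F'.val u σ a h' := by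
  subst e
  rfl

lemma val_comp_left (F : PushFamily i q n T) {T' T'' : E} (u' : T'' ⟶ T') (u : T' ⟶ T)
    {m : SimplexCategory} (σ : m ⟶ n) (a : T' ⟶ A.obj (op m)) (h) (h') :
    F.val (u' ≫ u) σ (u' ≫ a) h' = u' ≫ F.val u σ a h := by
  refine (F.val_congr rfl (Category.id_comp σ).symm (by simp) _
    (comp_map_app u' u (𝟙 m) σ a h)).trans ((F.val_comp u' u (𝟙 m) σ a h _).trans ?_)
  rw [op_id, X.map_id, Category.comp_id]

lemma val_comp_right (F : PushFamily i q n T) {T' : E} (u : T' ⟶ T) {m m' : SimplexCategory}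
    (ρ : m' ⟶ m) (σ : m ⟶ n) (a : T' ⟶ A.obj (op m)) (h) (h') :
    F.val u (ρ ≫ σ) (a ≫ A.map ρ.op) h' = F.val u σ a h ≫ X.map ρ.op :=
  (F.val_congr (Category.id_comp u).symm rfl (Category.id_comp _).symm _
    (comp_map_app (𝟙 T') u ρ σ a h)).trans ((F.val_comp (𝟙 T') u ρ σ a h _).trans
      (Category.id_comp _))

lemma ext_val {F F' : PushFamily i q n T} (hb : F.base = F'.base)
    (hF : ∀ ⦃T' : E⦄ (u : T' ⟶ T) ⦃m : SimplexCategory⦄ (σ : m ⟶ n) (a : T' ⟶ A.obj (op m)) (h) (h'),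
      F.val u σ a h = F'.val u σ a h') : F = F' := by
  obtain ⟨b, v, h₁, h₂⟩ := F
  obtain ⟨b', v', h₁', h₂'⟩ := F'
  obtain rfl : b = b' := hb
  obtain rfl : v = v' := by
    funext T' u m σ a h
    exact hF u σ a h h
  rfl

/-- Families are determined by their values on the faces of low dimension. -/
lemma ext_of_len_le (hi : ∀ m, Mono (i.app m)) {F F' : PushFamily i q n T} (hb : F.base = F'.base)
    (hF : ∀ ⦃T' : E⦄ (u : T' ⟶ T) ⦃m : SimplexCategory⦄ (σ : m ⟶ n) (a : T' ⟶ A.obj (op m)) (h) (h'),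
      m.len ≤ n.len → F.val u σ a h = F'.val u σ a h') : F = F' := by
  refine ext_val hb fun T' u m σ a h h' => ?_
  obtain ⟨k, ε, δ, γ, rfl, hγ, -, hk, -⟩ := exists_splitEpi_mono σ
  have hδ : ∀ b : T ⟶ B.obj (op n), a ≫ i.app (op m) = u ≫ b ≫ B.map (ε ≫ δ).op →
      (a ≫ A.map γ.op) ≫ i.app (op k) = u ≫ b ≫ B.map δ.op := fun b h => by
    rw [Category.assoc, i.naturality, ← Category.assoc, h, op_comp, B.map_comp]
    simp only [Category.assoc]
    rw [← B.map_comp, ← op_comp, hγ, op_id, B.map_id, Category.comp_id]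
  -- Both sides lie over the same simplex of `B`, and `i` is levelwise monic; thus `a` is a
  -- degeneracy of a face in `A` of low dimension.
  have ha : a = 𝟙 T' ≫ (a ≫ A.map γ.op) ≫ A.map ε.op := by
    have := hi (op m)
    rw [Category.id_comp, ← cancel_mono (i.app (op m)), Category.assoc, i.naturality,
      ← Category.assoc, hδ _ h, h]
    simp only [op_comp, B.map_comp, Category.assoc]
  have e : ∀ (G : PushFamily i q n T) (h), G.val u (ε ≫ δ) a h =
      𝟙 T' ≫ G.val u δ (a ≫ A.map γ.op) (hδ _ h) ≫ X.map ε.op := fun G h => by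
    rw [← G.val_comp (𝟙 T') u ε δ (a ≫ A.map γ.op) (hδ _ h) (by rw [← ha, h, Category.id_comp])]
    exact G.val_congr (Category.id_comp u).symm rfl ha _ _
  have hFδ := hF u δ _ (hδ _ h) (hδ _ h') hk
  rw [e F, e F', hFδ]

/-- Change of parameters for families. -/
def restrict (F : PushFamily i q n T) {S : E} (t : S ⟶ T) : PushFamily i q n S where
  base := t ≫ F.base
  val T' u m σ a h := F.val (u ≫ t) σ a (by simpa using h)
  val_comp_app T' u m σ a h := F.val_comp_app _ _ _ _
  val_comp T' T'' u' u m m' ρ σ a h h' := by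
    rw [← F.val_comp u' (u ≫ t) ρ σ a (by simpa using h) (by simpa using h')]
    exact F.val_congr (Category.assoc _ _ _) rfl rfl _ _

/-- The face operators on families. -/
def face (F : PushFamily i q n T) {n' : SimplexCategory} (θ : n' ⟶ n) : PushFamily i q n' T where
  base := F.base ≫ B.map θ.op
  val T' u m σ a h := F.val u (σ ≫ θ) a (by simpa using h)
  val_comp_app T' u m σ a h := F.val_comp_app _ _ _ _
  val_comp T' T'' u' u m m' ρ σ a h h' := by
    rw [← F.val_comp u' u ρ (σ ≫ θ) a (by simpa using h) (by simpa using h')]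
    exact F.val_congr rfl (Category.assoc _ _ _) rfl _ _

lemma restrict_restrict (F : PushFamily i q n T) {S S' : E} (t : S ⟶ T) (t' : S' ⟶ S) :
    (F.restrict t).restrict t' = F.restrict (t' ≫ t) :=
  ext_val (Category.assoc _ _ _).symm fun _ _ _ _ _ _ _ =>
    F.val_congr (Category.assoc _ _ _) rfl rfl _ _

lemma restrict_id (F : PushFamily i q n T) : F.restrict (𝟙 T) = F :=
  ext_val (Category.id_comp _) fun _ _ _ _ _ _ _ => F.val_congr (Category.comp_id _) rfl rfl _ _

lemma face_face (F : PushFamily i q n T) {n' n'' : SimplexCategory} (θ : n' ⟶ n) (θ' : n'' ⟶ n') :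
    (F.face θ).face θ' = F.face (θ' ≫ θ) :=
  ext_val (by simp [face]) fun _ _ _ _ _ _ _ => F.val_congr rfl (Category.assoc _ _ _) rfl _ _

lemma face_id (F : PushFamily i q n T) : F.face (𝟙 n) = F :=
  ext_val (by simp [face]) fun _ _ _ _ _ _ _ => F.val_congr rfl (Category.comp_id _) rfl _ _

lemma restrict_face (F : PushFamily i q n T) {S : E} (t : S ⟶ T) {n' : SimplexCategory}
    (θ : n' ⟶ n) : (F.restrict t).face θ = (F.face θ).restrict t :=
  ext_val (Category.assoc _ _ _) fun _ _ _ _ _ _ _ => rfl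

end PushFamily

/-- The low-dimensional faces of `n`. -/
abbrev LowFace (n : SimplexCategory) : Type := Σ k : Fin (n.len + 1), (⦋k⦌ ⟶ n)

variable {i : A ⟶ B} {q : X ⟶ A} {n : SimplexCategory}

/-- A compatible system of simplices of the levelwise pushforwards, indexed by the faces of low
dimension, gives a family. -/
lemma exists_pushFamily (hmono : ∀ m, Mono (i.app m))
    {Y : SimplexCategory → E} {β : ∀ m, Y m ⟶ B.obj (op m)} {ι : ∀ m, X.obj (op m) ⟶ Y m}
    (hmι : ∀ m, Mono (ι m)) (hιβ : ∀ m, ι m ≫ β m = q.app (op m) ≫ i.app (op m))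
    (hY : ∀ m ⦃T : E⦄ (y : T ⟶ Y m) (a : T ⟶ A.obj (op m)), a ≫ i.app (op m) = y ≫ β m →
      ∃ x, x ≫ ι m = y) {T : E} (b : T ⟶ B.obj (op n))
    (y : ∀ σ : LowFace n, T ⟶ Y ⦋σ.1⦌) (hy₁ : ∀ σ, y σ ≫ β _ = b ≫ B.map σ.2.op)
    (hy₂ : ∀ (σ σ' : LowFace n) (ρ : ⦋σ'.1⦌ ⟶ ⦋σ.1⦌), σ'.2 = ρ ≫ σ.2 → ∀ ⦃T' : E⦄ (u : T' ⟶ T)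
      (x : T' ⟶ X.obj (op ⦋σ.1⦌)), x ≫ ι _ = u ≫ y σ → x ≫ X.map ρ.op ≫ ι _ = u ≫ y σ') :
    ∃ F : PushFamily i q n T, F.base = b ∧ ∀ ⦃T' : E⦄ (u : T' ⟶ T) (σ : LowFace n) (a) (h),
      F.val u σ.2 a h ≫ ι _ = u ≫ y σ := by
  let idx : ∀ (m : SimplexCategory) (_ : m ⟶ n), m.len ≤ n.len → LowFace n := fun m σ hm =>
    ⟨⟨m.len, Nat.lt_succ_of_le hm⟩, σ⟩
  -- Where the face `σ` of `b` lies in `A`, the point of `Y` lies in the summand `X`; these elements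
  -- form the family in low dimensions.
  have hlow : ∀ ⦃T' : E⦄ (u : T' ⟶ T) (m : SimplexCategory) (σ : m ⟶ n)
      (_ : ∃ a : T' ⟶ A.obj (op m), a ≫ i.app (op m) = u ≫ b ≫ B.map σ.op) (hm : m.len ≤ n.len),
      ∃ x : T' ⟶ X.obj (op m), x ≫ ι m = u ≫ y (idx m σ hm) := by
    rintro T' u m σ ⟨a, ha⟩ hm
    refine hY m (u ≫ y (idx m σ hm)) a ?_
    rw [ha, Category.assoc]
    exact congrArg (u ≫ ·) (hy₁ (idx m σ hm)).symm
  choose x hx using hlow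
  have hS : ∀ ⦃T' : E⦄ (u : T' ⟶ T) ⦃m' m : SimplexCategory⦄ (ρ : m' ⟶ m) (σ : m ⟶ n),
      (∃ a : T' ⟶ A.obj (op m), a ≫ i.app (op m) = u ≫ b ≫ B.map σ.op) →
      ∃ a : T' ⟶ A.obj (op m'), a ≫ i.app (op m') = u ≫ b ≫ B.map (ρ ≫ σ).op := by
    rintro T' u m' m ρ σ ⟨a, ha⟩
    refine ⟨a ≫ A.map ρ.op, ?_⟩
    rw [Category.assoc, i.naturality, ← Category.assoc, ha, op_comp, B.map_comp]
    simp only [Category.assoc]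
  have hx' : ∀ ⦃T' : E⦄ (u : T' ⟶ T) (m' m : SimplexCategory) (ρ : m' ⟶ m) (σ : m ⟶ n) (h)
      (hm : m.len ≤ n.len) (hm' : m'.len ≤ n.len),
      x u m' (ρ ≫ σ) (hS u ρ σ h) hm' = x u m σ h hm ≫ X.map ρ.op := by
    intro T' u m' m ρ σ h hm hm'
    have := hmι m'
    rw [← cancel_mono (ι m'), hx, Category.assoc]
    exact (hy₂ (idx m σ hm) (idx m' (ρ ≫ σ) hm') ρ rfl u _ (hx u m σ h hm)).symm
  have hext := fun (T' : E) (u : T' ⟶ T) =>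
    existsUnique_extension (W := fun m => (T' ⟶ X.obj (op m)))
      (fun _ _ ρ x => x ≫ X.map ρ.op) (fun _ _ _ ρ' ρ x => by simp) (n := n)
      (fun m σ => ∃ a : T' ⟶ A.obj (op m), a ≫ i.app (op m) = u ≫ b ≫ B.map σ.op)
      (hS u) (fun k => k.len ≤ n.len)
      (fun k σ _ => by
        obtain ⟨j, ε, δ, γ, h₁, h₂, h₃, h₄, -⟩ := exists_splitEpi_mono σ
        exact ⟨j, ε, δ, γ, h₁, h₂, h₃, h₄⟩) (x u) (hx' u)
  choose z hz hzu using hext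
  have hzq : ∀ ⦃T' : E⦄ (u : T' ⟶ T) ⦃m : SimplexCategory⦄ (σ : m ⟶ n)
      (a : T' ⟶ A.obj (op m)) (h : a ≫ i.app (op m) = u ≫ b ≫ B.map σ.op),
      z T' u m σ ⟨a, h⟩ ≫ q.app (op m) = a := by
    have hzlow : ∀ ⦃T' : E⦄ (u : T' ⟶ T) ⦃m : SimplexCategory⦄ (σ : m ⟶ n)
        (a : T' ⟶ A.obj (op m)) (h : a ≫ i.app (op m) = u ≫ b ≫ B.map σ.op), m.len ≤ n.len →
        z T' u m σ ⟨a, h⟩ ≫ q.app (op m) = a := by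
      intro T' u m σ a h hm
      have := hmono (op m)
      rw [(hz T' u).2 m σ ⟨a, h⟩ hm, ← cancel_mono (i.app (op m)), Category.assoc, ← hιβ,
        ← Category.assoc, hx, Category.assoc, h]
      exact congrArg (u ≫ ·) (hy₁ (idx m σ hm))
    intro T' u m σ a h
    obtain ⟨k, ε, δ, γ, rfl, hγ, -, hk, -⟩ := exists_splitEpi_mono σ
    have hδ : (a ≫ A.map γ.op) ≫ i.app (op k) = u ≫ b ≫ B.map δ.op := by
      rw [Category.assoc, i.naturality, ← Category.assoc, h, op_comp, B.map_comp]
      simp only [Category.assoc]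
      rw [← B.map_comp, ← op_comp, hγ, op_id, B.map_id, Category.comp_id]
    have := hmono (op m)
    rw [(hz T' u).1 _ _ ε δ ⟨_, hδ⟩, Category.assoc, q.naturality, ← Category.assoc,
      hzlow u δ _ hδ hk, ← cancel_mono (i.app (op m)), Category.assoc, i.naturality,
      ← Category.assoc, hδ, h, op_comp, B.map_comp]
    simp only [Category.assoc]
  have hrestrict : ∀ ⦃T' T'' : E⦄ (u' : T'' ⟶ T') (u : T' ⟶ T) ⦃m : SimplexCategory⦄ (σ : m ⟶ n)
      (h : ∃ a : T' ⟶ A.obj (op m), a ≫ i.app (op m) = u ≫ b ≫ B.map σ.op)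
      (h' : ∃ a : T'' ⟶ A.obj (op m), a ≫ i.app (op m) = (u' ≫ u) ≫ b ≫ B.map σ.op),
      z T'' (u' ≫ u) m σ h' = u' ≫ z T' u m σ h := by
    have hlow : ∀ ⦃T' T'' : E⦄ (u' : T'' ⟶ T') (u : T' ⟶ T) ⦃m : SimplexCategory⦄ (σ : m ⟶ n)
        (h : ∃ a : T' ⟶ A.obj (op m), a ≫ i.app (op m) = u ≫ b ≫ B.map σ.op)
        (h' : ∃ a : T'' ⟶ A.obj (op m), a ≫ i.app (op m) = (u' ≫ u) ≫ b ≫ B.map σ.op),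
        m.len ≤ n.len → z T'' (u' ≫ u) m σ h' = u' ≫ z T' u m σ h := by
      intro T' T'' u' u m σ h h' hm
      have := hmι m
      rw [(hz _ _).2 m σ h' hm, (hz _ _).2 m σ h hm, ← cancel_mono (ι m), hx, Category.assoc,
        Category.assoc, hx]
    intro T' T'' u' u m σ h h'
    obtain ⟨k, ε, δ, γ, rfl, hγ, -, hk, -⟩ := exists_splitEpi_mono σ
    have hδ : ∃ a : T' ⟶ A.obj (op k), a ≫ i.app (op k) = u ≫ b ≫ B.map δ.op := by
      have := hS u γ (ε ≫ δ) h
      rwa [← Category.assoc γ, hγ, Category.id_comp] at this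
    have hδ' : ∃ a : T'' ⟶ A.obj (op k), a ≫ i.app (op k) = (u' ≫ u) ≫ b ≫ B.map δ.op := by
      have := hS (u' ≫ u) γ (ε ≫ δ) h'
      rwa [← Category.assoc γ, hγ, Category.id_comp] at this
    rw [(hz _ _).1 _ _ ε δ hδ, (hz _ _).1 _ _ ε δ hδ', hlow u' u δ hδ hδ' hk, Category.assoc]
  refine ⟨⟨b, fun T' u m σ a h => z T' u m σ ⟨a, h⟩, hzq, ?_⟩, rfl, ?_⟩
  · intro T' T'' u' u m m' ρ σ a h h'
    have hu : (u' ≫ a) ≫ i.app (op m) = (u' ≫ u) ≫ b ≫ B.map σ.op := by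
      rw [Category.assoc, h, Category.assoc]
    refine ((hz T'' (u' ≫ u)).1 m' m ρ σ ⟨_, hu⟩).trans ?_
    rw [hrestrict u' u σ ⟨a, h⟩ ⟨_, hu⟩, Category.assoc]
  · rintro T' u ⟨k, σ⟩ a h
    have hk : (⦋k⦌ : SimplexCategory).len ≤ n.len := Nat.le_of_lt_succ k.2
    refine (congrArg (· ≫ ι ⦋k⦌) ((hz T' u).2 ⦋k⦌ σ ⟨a, h⟩ hk)).trans ?_
    exact hx u ⦋k⦌ σ ⟨a, h⟩ hk

variable [CountablyLextensive E]

/-- The families over a fixed dimension are representable. -/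
lemma exists_representing_pushFamily
    (hi : ∀ m, ∃ (C : E) (c : C ⟶ B.obj m), Nonempty (IsColimit (BinaryCofan.mk (i.app m) c)))
    (q : X ⟶ A) (n : SimplexCategory) :
    ∃ (P : E) (ξ : PushFamily i q n P), ∀ ⦃T : E⦄ (F : PushFamily i q n T),
      ∃! t : T ⟶ P, ξ.restrict t = F := by
  choose C c hc using hi
  have hmono : ∀ m, Mono (i.app m) := fun m =>
    FinitaryExtensive.mono_inl_of_isColimit (hc m).some
  choose Y β ι κ hmι hcol hιβ hY hval using fun m : SimplexCategory =>
    exists_pushforward_of_isColimit (hc (op m)).some (q.app (op m))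
  -- The finitely many compatibility conditions: pairs of low faces, the second obtained from the
  -- first by an operator.
  let K : Type := { p : Σ τ : LowFace n × LowFace n, (⦋τ.2.1⦌ ⟶ ⦋τ.1.1⦌) // p.1.2.2 = p.2 ≫ p.1.1.2 }
  let π : ∀ σ : LowFace n, (B.obj (op n) ⨯ ∏ᶜ fun σ : LowFace n => Y ⦋σ.1⦌) ⟶ Y ⦋σ.1⦌ :=
    fun σ => prod.snd ≫ Pi.π (fun σ : LowFace n => Y ⦋σ.1⦌) σ
  have hπ : ∀ ⦃T : E⦄ (b : T ⟶ B.obj (op n)) (y : ∀ σ : LowFace n, T ⟶ Y ⦋σ.1⦌) (σ),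
      prod.lift b (Pi.lift y) ≫ π σ = y σ := fun T b y σ => by
    rw [← Category.assoc, prod.lift_snd, Pi.lift_π]
  -- The condition for `p` reads: if the first coordinate lies in `X`, then applying the operator
  -- gives the second coordinate. It becomes the equation `e p = π _`.
  choose e he using fun p : K => exists_conditional (hcol ⦋p.1.1.1.1⦌).some (π p.1.1.1) (π p.1.1.2)
    (X.map p.1.2.op ≫ ι _)
  obtain ⟨P, ϖ, η, hη, hP⟩ := exists_solutionObject (I := LowFace n) (J := LowFace n ⊕ K)
    (B.obj (op n)) (fun σ => Y ⦋σ.1⦌) (Sum.elim (fun σ => B.obj (op ⦋σ.1⦌)) fun p => Y ⦋p.1.1.2.1⦌)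
    (fun j => match j with
      | .inl σ => π σ ≫ β _
      | .inr p => e p)
    (fun j => match j with
      | .inl σ => prod.fst ≫ B.map σ.2.op
      | .inr p => π p.1.1.2)
  have hiff : ∀ ⦃T : E⦄ (b : T ⟶ B.obj (op n)) (y : ∀ σ : LowFace n, T ⟶ Y ⦋σ.1⦌) (p : K),
      prod.lift b (Pi.lift y) ≫ e p = prod.lift b (Pi.lift y) ≫ π p.1.1.2 ↔
        ∀ ⦃T' : E⦄ (u : T' ⟶ T) (x : T' ⟶ X.obj (op ⦋p.1.1.1.1⦌)), x ≫ ι _ = u ≫ y p.1.1.1 →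
          x ≫ X.map p.1.2.op ≫ ι _ = u ≫ y p.1.1.2 := fun T b y p => by
    rw [he p, hπ, hπ]
  have hiff' : ∀ ⦃T : E⦄ (b : T ⟶ B.obj (op n)) (y : ∀ σ : LowFace n, T ⟶ Y ⦋σ.1⦌) (σ : LowFace n),
      prod.lift b (Pi.lift y) ≫ π σ ≫ β _ = prod.lift b (Pi.lift y) ≫ prod.fst ≫ B.map σ.2.op ↔
        y σ ≫ β _ = b ≫ B.map σ.2.op := fun T b y σ => by
    rw [← Category.assoc, hπ, ← Category.assoc, prod.lift_fst]
  obtain ⟨ξ, hξb, hξ⟩ := exists_pushFamily (q := q) hmono hmι hιβ hY ϖ η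
    (fun σ => (hiff' ϖ η σ).1 (hη (.inl σ)))
    (fun σ σ' ρ h => (hiff ϖ η ⟨⟨(σ, σ'), ρ⟩, h⟩).1 (hη (.inr ⟨⟨(σ, σ'), ρ⟩, h⟩)))
  subst hξb
  refine ⟨P, ξ, fun T F => ?_⟩
  choose y hy hyu using fun σ : LowFace n => hval ⦋σ.1⦌ (F.base ≫ B.map σ.2.op)
    (fun T' u a h => F.val u σ.2 a h) (fun T' u a h => F.val_comp_app _ _ _ _)
    (fun T' T'' u' u a h h' => F.val_comp_left u' u σ.2 a h h')
  have hxF : ∀ (σ : LowFace n) ⦃T' : E⦄ (u : T' ⟶ T) (x : T' ⟶ X.obj (op ⦋σ.1⦌)),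
      x ≫ ι _ = u ≫ y σ → ∃ (a : _) (h : _), x = F.val u σ.2 a h := by
    intro σ T' u x hx
    have h : (x ≫ q.app (op ⦋σ.1⦌)) ≫ i.app (op ⦋σ.1⦌) = u ≫ F.base ≫ B.map σ.2.op := by
      rw [Category.assoc, ← hιβ, ← Category.assoc, hx, Category.assoc, (hy σ).1]
    have := hmι ⦋σ.1⦌
    exact ⟨_, h, by rw [← cancel_mono (ι ⦋σ.1⦌), hx, (hy σ).2 u _ h]⟩
  have hcompat : ∀ (σ : LowFace n) (k : Fin (n.len + 1)) (σ' : ⦋k⦌ ⟶ n) (ρ : ⦋k⦌ ⟶ ⦋σ.1⦌),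
      σ' = ρ ≫ σ.2 → ∀ ⦃T' : E⦄ (u : T' ⟶ T) (x : T' ⟶ X.obj (op ⦋σ.1⦌)), x ≫ ι _ = u ≫ y σ →
      x ≫ X.map ρ.op ≫ ι _ = u ≫ y ⟨k, σ'⟩ := by
    rintro σ k _ ρ rfl T' u x hx
    obtain ⟨a, ha, rfl⟩ := hxF σ u x hx
    have h₁ := PushFamily.comp_map_app (𝟙 T') u ρ σ.2 a ha
    rw [Category.id_comp, Category.id_comp] at h₁
    refine Eq.trans ?_ ((hy ⟨k, ρ ≫ σ.2⟩).2 u (a ≫ A.map ρ.op) h₁)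
    exact (Category.assoc _ _ _).symm.trans
      (congrArg (· ≫ ι ⦋k⦌) (F.val_comp_right u ρ σ.2 a ha h₁).symm)
  obtain ⟨t, ⟨ht₁, ht₂⟩, htu⟩ := hP F.base y (by
    rintro (σ | ⟨⟨⟨σ, σ'⟩, ρ⟩, h⟩)
    · exact (hiff' F.base y σ).2 (hy σ).1
    · refine (hiff F.base y ⟨⟨(σ, σ'), ρ⟩, h⟩).2 fun T' u x hx => ?_
      exact hcompat σ _ _ ρ h u x hx)
  refine ⟨t, PushFamily.ext_of_len_le hmono ht₁ ?_, ?_⟩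
  · intro T' u m σ a h h' hm
    have := hmι m
    rw [← cancel_mono (ι m)]
    let σ₀ : LowFace n := ⟨⟨m.len, Nat.lt_succ_of_le hm⟩, σ⟩
    refine (hξ (u ≫ t) σ₀ a (by simpa [PushFamily.restrict] using h)).trans ?_
    rw [Category.assoc, ht₂]
    exact ((hy σ₀).2 u a h').symm
  · rintro t' rfl
    refine htu t' ⟨rfl, fun σ => hyu σ _ ⟨?_, fun T' u a h => ?_⟩⟩
    · rw [Category.assoc, (hiff' ξ.base η σ).1 (hη (.inl σ))]
      exact (Category.assoc _ _ _).symm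
    · refine (hξ (u ≫ t') σ a (by simpa [PushFamily.restrict] using h)).trans ?_
      rw [Category.assoc]

end Families

/-! ### A universal property characterizing pushforwards. -/

section Terminal

variable {C : Type u} [Category.{v} C] [HasPullbacks C] {A B : C}

/-- A criterion for an object to be a pushforward. -/
lemma nonempty_isTerminal_costructuredArrow (i : A ⟶ B) (q : Over A) {P : C} (ϖ : P ⟶ B)
    (ε : pullback ϖ i ⟶ q.left) (hε : ε ≫ q.hom = pullback.snd ϖ i)
    (h : ∀ ⦃Z : C⦄ (p : Z ⟶ B) (g : pullback p i ⟶ q.left), g ≫ q.hom = pullback.snd p i →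
      ∃! f : Z ⟶ P, f ≫ ϖ = p ∧ ∀ w : pullback p i ⟶ pullback ϖ i,
        w ≫ pullback.fst ϖ i = pullback.fst p i ≫ f → w ≫ pullback.snd ϖ i = pullback.snd p i →
        w ≫ ε = g) :
    Nonempty (IsTerminal (CostructuredArrow.mk
      (Over.homMk ε hε : (Over.pullback i).obj (Over.mk ϖ) ⟶ q))) := by
  have hmap : ∀ {Z : Over B} (f : Z ⟶ Over.mk ϖ),
      ((Over.pullback i).map f).left ≫ pullback.fst ϖ i = pullback.fst Z.hom i ≫ f.left ∧
      ((Over.pullback i).map f).left ≫ pullback.snd ϖ i = pullback.snd Z.hom i := fun f =>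
    ⟨pullback.lift_fst _ _ _, pullback.lift_snd _ _ _⟩
  have huniq : ∀ Y : CostructuredArrow (Over.pullback i) q, ∃! f : Y.left ⟶ Over.mk ϖ,
      (Over.pullback i).map f ≫ (Over.homMk ε hε : (Over.pullback i).obj (Over.mk ϖ) ⟶ q) =
        Y.hom := by
    intro Y
    obtain ⟨f, ⟨hf₁, hf₂⟩, hf⟩ := h Y.left.hom Y.hom.left (Over.w Y.hom)
    refine ⟨Over.homMk f hf₁, ?_, fun f' hf' => ?_⟩
    · ext1
      exact hf₂ _ (hmap (Over.homMk f hf₁ : Y.left ⟶ Over.mk ϖ)).1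
        (hmap (Over.homMk f hf₁ : Y.left ⟶ Over.mk ϖ)).2
    · ext1
      refine hf f'.left ⟨Over.w f', fun w hw₁ hw₂ => ?_⟩
      obtain rfl : w = ((Over.pullback i).map f').left :=
        pullback.hom_ext (hw₁.trans (hmap f').1.symm) (hw₂.trans (hmap f').2.symm)
      exact congrArg (fun φ => φ.left) hf'
  choose f hf hfu using huniq
  exact ⟨IsTerminal.ofUniqueHom (fun Y => CostructuredArrow.homMk (f Y) (hf Y)) fun Y m =>
    CostructuredArrow.ext _ _ (hfu Y m.left (CostructuredArrow.w m))⟩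

end Terminal

/-! ### The representing simplicial object is the pushforward. -/

section Pushforward

variable {E : Type u} [Category.{v} E] {A B X : SimplicialObject E} {i : A ⟶ B} {q : X ⟶ A}

variable {P : SimplicialObject E} {ξ : ∀ n, PushFamily i q n (P.obj (op n))}

/-- Evaluating the universal family at a face of `t` amounts to evaluating it at the identity face
of the corresponding simplex of `P`. Hence the counit, which uses only identity faces, determines
all values. -/
lemma val_comp_map_id
    (hξ : ∀ ⦃n' n : SimplexCategory⦄ (θ : n' ⟶ n), (ξ n').restrict (P.map θ.op) = (ξ n).face θ)
    {m n : SimplexCategory} (σ : m ⟶ n) {T : E} (t : T ⟶ P.obj (op n))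
    (a : T ⟶ A.obj (op m)) (h) (h') :
    (ξ m).val (t ≫ P.map σ.op) (𝟙 m) a h = (ξ n).val t σ a h' := by
  have h₁ : a ≫ i.app (op m) = t ≫ ((ξ m).restrict (P.map σ.op)).base ≫ B.map (𝟙 m).op := by
    rw [h]
    simp [PushFamily.restrict]
  have h₂ : a ≫ i.app (op m) = t ≫ ((ξ n).face σ).base ≫ B.map (𝟙 m).op := by
    rw [← hξ, h₁]
  exact (PushFamily.val_eq_of_eq (hξ σ) t (𝟙 m) a h₁ h₂).trans
    ((ξ n).val_congr rfl (Category.id_comp σ) rfl _ _)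

variable [CountablyLextensive E]

/-- The families of all dimensions are represented by a simplicial object. -/
lemma exists_representing_simplicialObject
    (hi : ∀ m, ∃ (C : E) (c : C ⟶ B.obj m), Nonempty (IsColimit (BinaryCofan.mk (i.app m) c)))
    (q : X ⟶ A) :
    ∃ (P : SimplicialObject E) (ξ : ∀ n, PushFamily i q n (P.obj (op n))),
      (∀ ⦃n' n : SimplexCategory⦄ (θ : n' ⟶ n),
        (ξ n').restrict (P.map θ.op) = (ξ n).face θ) ∧
      ∀ (n : SimplexCategory) ⦃T : E⦄ (F : PushFamily i q n T), ∃! t, (ξ n).restrict t = F := by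
  choose P ξ hξ using exists_representing_pushFamily hi q
  choose f hf hfu using hξ
  have hext : ∀ (n : SimplexCategory) ⦃T : E⦄ (t t' : T ⟶ P n),
      (ξ n).restrict t = (ξ n).restrict t' → t = t' := fun n T t t' h =>
    (hfu n _ t h).trans (hfu n _ t' rfl).symm
  refine ⟨{ obj := fun n => P n.unop
            map := fun θ => f _ ((ξ _).face θ.unop)
            map_id := fun n => ?_
            map_comp := fun θ θ' => ?_ }, ξ, fun n' n θ => hf _ _, fun n T F =>
    ⟨f n F, hf n F, hfu n F⟩⟩
  · apply hext
    rw [hf, PushFamily.restrict_id]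
    exact PushFamily.face_id _
  · apply hext
    rw [hf, ← PushFamily.restrict_restrict, hf, ← PushFamily.restrict_face, hf,
      PushFamily.face_face]
    rfl

/-- A simplicial object which represents the families of all dimensions is a pushforward. -/
lemma exists_isTerminal_of_representing
    (hξ : ∀ ⦃n' n : SimplexCategory⦄ (θ : n' ⟶ n), (ξ n').restrict (P.map θ.op) = (ξ n).face θ)
    (hP : ∀ (n : SimplexCategory) ⦃T : E⦄ (F : PushFamily i q n T), ∃! t, (ξ n).restrict t = F) :
    ∃ (ϖ : P ⟶ B) (ε : (Over.pullback i).obj (Over.mk ϖ) ⟶ Over.mk q),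
      Nonempty (IsTerminal (CostructuredArrow.mk ε)) := by
  let ϖ : P ⟶ B :=
    { app := fun n => (ξ n.unop).base
      naturality := fun n n' θ => congrArg PushFamily.base (hξ θ.unop) }
  have hcond : ∀ {Z : SimplicialObject E} (p : Z ⟶ B) (m : SimplexCategoryᵒᵖ),
      (pullback.snd p i).app m ≫ i.app m = (pullback.fst p i).app m ≫ p.app m := fun p m =>
    (NatTrans.congr_app (pullback.condition (f := p) (g := i)) m).symm
  have hε : ∀ m : SimplexCategoryᵒᵖ, (pullback.snd ϖ i).app m ≫ i.app m =
      (pullback.fst ϖ i).app m ≫ (ξ m.unop).base ≫ B.map (𝟙 m.unop).op := fun m => by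
    rw [hcond, op_id, B.map_id, Category.comp_id]
  -- The counit evaluates the universal family at the top face, which on the pullback lies in `A`.
  let ε : pullback ϖ i ⟶ X :=
    { app := fun m => (ξ m.unop).val ((pullback.fst ϖ i).app m) (𝟙 _) ((pullback.snd ϖ i).app m)
        (hε m)
      naturality := fun m m' ρ => by
        have hn : (ξ m'.unop).val ((pullback.fst ϖ i).app m ≫ P.map ρ) (𝟙 _)
            ((pullback.snd ϖ i).app m ≫ A.map ρ) (by
              rw [← (pullback.fst ϖ i).naturality, ← (pullback.snd ϖ i).naturality, Category.assoc,
                hε, Category.assoc]) =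
            (ξ m.unop).val ((pullback.fst ϖ i).app m) (𝟙 _) ((pullback.snd ϖ i).app m) (hε m) ≫
              X.map ρ := by
          have h' := PushFamily.comp_map_app (𝟙 _) ((pullback.fst ϖ i).app m) ρ.unop (𝟙 _) _ (hε m)
          rw [Category.id_comp, Category.id_comp] at h'
          refine Eq.trans ?_ ((ξ m.unop).val_comp_right _ ρ.unop (𝟙 _) _ (hε m) h')
          refine (val_comp_map_id hξ ρ.unop _ _ _ (by simpa using h')).trans ?_
          exact (ξ m.unop).val_congr rfl (Category.comp_id _).symm rfl _ _
        rw [← hn, ← (ξ m'.unop).val_comp_left _ _ (𝟙 _) _ (hε m') (by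
          rw [Category.assoc, hε, Category.assoc])]
        exact (ξ m'.unop).val_congr ((pullback.fst ϖ i).naturality ρ) rfl
          ((pullback.snd ϖ i).naturality ρ) _ _ }
  refine ⟨ϖ, Over.homMk ε ?_, nonempty_isTerminal_costructuredArrow i (Over.mk q) ϖ ε _ ?_⟩
  · ext m
    exact (ξ m.unop).val_comp_app _ _ _ _
  · intro Z p (g : pullback p i ⟶ X) (hg : g ≫ q = pullback.snd p i)
    have hpb : ∀ m : SimplexCategoryᵒᵖ, IsPullback ((pullback.fst p i).app m)
        ((pullback.snd p i).app m) (p.app m) (i.app m) := fun m =>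
      (IsPullback.of_hasPullback p i).map ((evaluation _ _).obj m)
    have hl : ∀ ⦃n : SimplexCategory⦄ ⦃T' : E⦄ (u : T' ⟶ Z.obj (op n)) ⦃m : SimplexCategory⦄
        (σ : m ⟶ n) (a : T' ⟶ A.obj (op m)), a ≫ i.app (op m) = u ≫ p.app (op n) ≫ B.map σ.op →
        ∃ l : T' ⟶ (pullback p i).obj (op m), l ≫ (pullback.fst p i).app (op m) = u ≫ Z.map σ.op ∧
          l ≫ (pullback.snd p i).app (op m) = a := by
      intro n T' u m σ a h
      have h' : (u ≫ Z.map σ.op) ≫ p.app (op m) = a ≫ i.app (op m) := by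
        rw [Category.assoc, p.naturality, h]
      exact ⟨(hpb (op m)).lift _ _ h', (hpb (op m)).lift_fst _ _ h', (hpb (op m)).lift_snd _ _ h'⟩
    choose l hl₁ hl₂ using hl
    -- The transpose of `g`: a face of a simplex of `Z`, together with a lift to `A` of its image in
    -- `B`, is a point of the pullback, to which `g` is applied.
    let G : ∀ n, PushFamily i q n (Z.obj (op n)) := fun n =>
      { base := p.app (op n)
        val := fun T' u m σ a h => l u σ a h ≫ g.app (op m)
        val_comp_app := fun T' u m σ a h => by
          have e : g.app (op m) ≫ q.app (op m) = (pullback.snd p i).app (op m) :=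
            NatTrans.congr_app hg (op m)
          rw [Category.assoc, e, hl₂]
        val_comp := fun T' T'' u' u m m' ρ σ a h h' => by
          rw [Category.assoc, ← g.naturality]
          have := Category.assoc (u' ≫ l u σ a h) ((pullback p i).map ρ.op) (g.app (op m'))
          refine Eq.trans (congrArg (· ≫ g.app (op m')) ?_) (this.trans (Category.assoc _ _ _))
          apply (hpb (op m')).hom_ext
          · rw [hl₁]
            simp only [Category.assoc]
            rw [(pullback.fst p i).naturality, ← Category.assoc (l u σ a h), hl₁, op_comp,
              Z.map_comp, Category.assoc]
          · rw [hl₂]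
            simp only [Category.assoc]
            rw [(pullback.snd p i).naturality, ← Category.assoc (l u σ a h), hl₂] }
    have hG : ∀ ⦃n' n : SimplexCategory⦄ (θ : n' ⟶ n),
        (G n').restrict (Z.map θ.op) = (G n).face θ := by
      intro n' n θ
      refine PushFamily.ext_val (p.naturality θ.op) fun T' u m σ a h h' => ?_
      refine congrArg (· ≫ g.app (op m)) ?_
      apply (hpb (op m)).hom_ext
      · rw [hl₁, hl₁, op_comp, Z.map_comp, Category.assoc]
      · rw [hl₂, hl₂]
    choose f hf hfu using fun n => hP n (G n)
    have hext : ∀ (n : SimplexCategory) ⦃T : E⦄ (t t' : T ⟶ P.obj (op n)),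
        (ξ n).restrict t = (ξ n).restrict t' → t = t' := fun n T t t' h =>
      (hP n _).unique h rfl
    let φ : Z ⟶ P :=
      { app := fun n => f n.unop
        naturality := fun n n' θ => by
          apply hext
          rw [← PushFamily.restrict_restrict, hf, ← PushFamily.restrict_restrict]
          exact (hG θ.unop).trans (by rw [← hf, PushFamily.restrict_face, ← hξ]; rfl) }
    have hφ : φ ≫ ϖ = p := by
      ext n
      exact congrArg PushFamily.base (hf n.unop)
    -- The composite of the pullback of `ψ` with the counit, computed on elements; it serves both
    -- for existence and for uniqueness.
    have hw : ∀ (ψ : Z ⟶ P) (_ : ψ ≫ ϖ = p) (w : pullback p i ⟶ pullback ϖ i),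
        w ≫ pullback.fst ϖ i = pullback.fst p i ≫ ψ → w ≫ pullback.snd ϖ i = pullback.snd p i →
        ∀ (m : SimplexCategory) ⦃T : E⦄ (t : T ⟶ (pullback p i).obj (op m)),
        ∃ h, t ≫ (w ≫ ε).app (op m) = (ξ m).val (t ≫ (pullback.fst p i).app (op m) ≫ ψ.app (op m))
          (𝟙 m) (t ≫ (pullback.snd p i).app (op m)) h := by
      intro ψ hψ w hw₁ hw₂ m T t
      have h₁ := NatTrans.congr_app hw₁ (op m)
      have h₂ := NatTrans.congr_app hw₂ (op m)
      rw [NatTrans.comp_app] at h₁ h₂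
      rw [NatTrans.comp_app] at h₁
      have h : (t ≫ w.app (op m) ≫ (pullback.snd ϖ i).app (op m)) ≫ i.app (op m) =
          (t ≫ w.app (op m) ≫ (pullback.fst ϖ i).app (op m)) ≫ (ξ m).base ≫ B.map (𝟙 m).op := by
        simp only [Category.assoc]
        exact congrArg (fun x => t ≫ w.app (op m) ≫ x) (hε (op m))
      refine ⟨by rw [← h₁, ← h₂, h], ?_⟩
      rw [NatTrans.comp_app, ← Category.assoc]
      refine ((ξ m).val_comp_left (t ≫ w.app (op m)) _ (𝟙 m) _ (hε (op m))
        (by simpa only [Category.assoc] using h)).symm.trans ?_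
      exact (ξ m).val_congr (by rw [← h₁, Category.assoc]) rfl (by rw [← h₂, Category.assoc]) _ _
    refine ⟨φ, ⟨hφ, fun w hw₁ hw₂ => ?_⟩, fun ψ hψ => ?_⟩
    · ext m
      obtain ⟨h, e⟩ := hw φ hφ w hw₁ hw₂ m.unop (𝟙 _)
      have h₁ : (pullback.snd p i).app m ≫ i.app m =
          (pullback.fst p i).app m ≫ p.app m ≫ B.map (𝟙 m.unop).op := by
        rw [op_id, B.map_id, Category.comp_id, hcond]
      have h₂ : (pullback.snd p i).app m ≫ i.app m =
          (pullback.fst p i).app m ≫ ((ξ m.unop).restrict (f m.unop)).base ≫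
            B.map (𝟙 m.unop).op := by
        rw [hf]
        exact h₁
      refine (Category.id_comp _).symm.trans (e.trans ?_)
      refine ((ξ m.unop).val_congr (Category.id_comp _) rfl (Category.id_comp _) _
        (h₂.trans (by simp [PushFamily.restrict, φ]))).trans
        ((PushFamily.val_eq_of_eq (hf m.unop) _ (𝟙 _) _ h₂ h₁).trans ?_)
      have hid : l ((pullback.fst p i).app m) (𝟙 _) ((pullback.snd p i).app m) h₁ = 𝟙 _ := by
        apply (hpb m).hom_ext
        · refine (hl₁ _ _ _ _).trans ?_
          rw [op_id, Z.map_id, Category.comp_id, Category.id_comp]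
        · exact (hl₂ _ _ _ _).trans (Category.id_comp _).symm
      exact (congrArg (· ≫ g.app m) hid).trans (Category.id_comp _)
    · ext n
      refine hfu n.unop _ (PushFamily.ext_val (NatTrans.congr_app hψ.1 n) fun T' u m σ a h h' => ?_)
      have hlift : (pullback.fst p i ≫ ψ) ≫ ϖ = pullback.snd p i ≫ i := by
        rw [Category.assoc, hψ.1, pullback.condition]
      have hw₁ := pullback.lift_fst _ _ hlift
      have hw₂ := pullback.lift_snd _ _ hlift
      obtain ⟨h₁, e⟩ := hw ψ hψ.1 _ hw₁ hw₂ m (l u σ a h')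
      rw [hψ.2 _ hw₁ hw₂] at e
      refine Eq.trans ?_ e.symm
      have hu : (u ≫ ψ.app n) ≫ P.map σ.op =
          l u σ a h' ≫ (pullback.fst p i).app (op m) ≫ ψ.app (op m) := by
        rw [← Category.assoc, hl₁, Category.assoc, Category.assoc]
        exact congrArg (u ≫ ·) (ψ.naturality σ.op).symm
      have h₂ : a ≫ i.app (op m) = ((u ≫ ψ.app n) ≫ P.map σ.op) ≫ (ξ m).base ≫ B.map (𝟙 m).op := by
        rw [hu, ← h₁, hl₂]
      exact (val_comp_map_id hξ σ (u ≫ ψ.app n) a h₂ _).symm.trans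
        ((ξ m).val_congr hu rfl (hl₂ u σ a h').symm _ _)

end Pushforward

/-! ### Faces stable under an idempotent. -/

section Combinatorics

lemma exists_lift_of_mono {k m n : SimplexCategory} (δ : k ⟶ n) [Mono δ] (τ : m ⟶ n)
    (h : ∀ x, ∃ y, δ.toOrderHom y = τ.toOrderHom x) : ∃ τ' : m ⟶ k, τ' ≫ δ = τ := by
  have hδ : StrictMono δ.toOrderHom :=
    δ.toOrderHom.monotone.strictMono_of_injective (SimplexCategory.mono_iff_injective.1 inferInstance)
  choose f hf using h
  refine ⟨SimplexCategory.Hom.mk ⟨f, fun x y hxy => ?_⟩, ?_⟩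
  · rw [← hδ.le_iff_le, hf, hf]
    exact τ.toOrderHom.monotone hxy
  · ext x : 3
    exact hf x

/-- Every face `σ` of a simplex with an idempotent `e` is contained in a face `δ` which is stable
under `e`, and whose image under `e` is the same as that of `σ`. -/
lemma exists_stable_face {m n : SimplexCategory} (e : n ⟶ n) (he : e ≫ e = e) (σ : m ⟶ n) :
    ∃ (k : SimplexCategory) (δ : k ⟶ n) (e' : k ⟶ k) (σ' : m ⟶ k) (κ : k ⟶ m), k.len ≤ n.len ∧
      e' ≫ e' = e' ∧ e' ≫ δ = δ ≫ e ∧ σ' ≫ δ = σ ∧ κ ≫ σ ≫ e = δ ≫ e := by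
  classical
  have hee : ∀ x, e.toOrderHom (e.toOrderHom x) = e.toOrderHom x := fun x =>
    congrArg (fun f => f.toOrderHom x) he
  -- The vertices with the same image under `e` as some vertex of `σ`: the saturation of `σ`, stable
  -- under `e` by idempotence.
  let F : Finset (Fin (n.len + 1)) :=
    Finset.univ.filter fun x => ∃ j, e.toOrderHom (σ.toOrderHom j) = e.toOrderHom x
  have hF : ∀ x, x ∈ F ↔ ∃ j, e.toOrderHom (σ.toOrderHom j) = e.toOrderHom x := fun x => by
    simp [F]
  have hcard : F.card = F.card - 1 + 1 :=
    (Nat.succ_pred_eq_of_pos (Finset.card_pos.2 ⟨σ.toOrderHom 0, (hF _).2 ⟨0, rfl⟩⟩)).symm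
  let δ : ⦋F.card - 1⦌ ⟶ n := SimplexCategory.Hom.mk (F.orderEmbOfFin hcard).toOrderHom
  have hδ : ∀ x, x ∈ F ↔ ∃ y, δ.toOrderHom y = x := fun x => by
    have := Finset.range_orderEmbOfFin F hcard
    exact (Set.ext_iff.1 this x).symm
  have hmono : Mono δ := SimplexCategory.mono_iff_injective.2 (F.orderEmbOfFin hcard).injective
  obtain ⟨σ', hσ'⟩ := exists_lift_of_mono δ σ fun x => (hδ _).1 ((hF _).2 ⟨x, rfl⟩)
  obtain ⟨e', he'⟩ := exists_lift_of_mono δ (δ ≫ e) fun x => by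
    obtain ⟨j, hj⟩ := (hF _).1 ((hδ _).2 ⟨x, rfl⟩)
    refine (hδ _).1 ((hF _).2 ⟨j, hj.trans ?_⟩)
    exact (hee _).symm
  -- The preimage is chosen as a function of the value `v`, so that equal values give equal choices;
  -- this makes `κ` monotone. The default `0` is used only for values not attained.
  have hj : ∀ v, ∃ j, (∃ j', e.toOrderHom (σ.toOrderHom j') = v) → e.toOrderHom (σ.toOrderHom j) = v :=
    fun v => by
      by_cases h : ∃ j', e.toOrderHom (σ.toOrderHom j') = v
      · exact ⟨h.choose, fun _ => h.choose_spec⟩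
      · exact ⟨0, fun h' => (h h').elim⟩
  choose c hc using hj
  have hcδ : ∀ x, e.toOrderHom (σ.toOrderHom (c (e.toOrderHom (δ.toOrderHom x)))) =
      e.toOrderHom (δ.toOrderHom x) := fun x => hc _ ((hF _).1 ((hδ _).2 ⟨x, rfl⟩))
  refine ⟨_, δ, e', σ', SimplexCategory.Hom.mk ⟨fun x => c (e.toOrderHom (δ.toOrderHom x)), ?_⟩,
    SimplexCategory.len_le_of_mono δ, ?_, he', hσ', ?_⟩
  · intro x y hxy
    have hle : e.toOrderHom (δ.toOrderHom x) ≤ e.toOrderHom (δ.toOrderHom y) :=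
      e.toOrderHom.monotone (δ.toOrderHom.monotone hxy)
    rcases hle.eq_or_lt with h | h
    · exact (congrArg c h).le
    · refine le_of_not_ge fun h' => h.not_ge ?_
      rw [← hcδ x, ← hcδ y]
      exact e.toOrderHom.monotone (σ.toOrderHom.monotone h')
  · rw [← cancel_mono δ, Category.assoc, he', ← Category.assoc, he', Category.assoc, he]
  · ext x : 3
    exact hcδ x

end Combinatorics

/-! ### Degeneracy as fixedness under idempotents. -/

section Fixed

variable {E : Type u} [Category.{v} E]

lemma sieve_iSup_apply_iff {J : Type w} {V T : E} (S : J → Sieve V) (t : T ⟶ V) :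
    (⨆ j, S j) t ↔ ∃ j, S j t := by
  simp [iSup, Sieve.sSup_apply]

lemma sieve_iInf_apply_iff {J : Type w} {V T : E} (S : J → Sieve V) (t : T ⟶ V) :
    (⨅ j, S j) t ↔ ∀ j, S j t := by
  simp [iInf, Sieve.sInf_apply]

/-- The sieve of simplices which are fixed by an operator. -/
def fixedSieve (X : SimplicialObject E) {n : SimplexCategory} (e : n ⟶ n) :
    Sieve (X.obj (op n)) where
  arrows T t := t ≫ X.map e.op = t
  downward_closed h u := by rw [Category.assoc, h]

/-- A simplex is degenerate if and only if it is fixed by a nontrivial idempotent. -/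
lemma degenerateSieve_eq (X : SimplicialObject E) (m : SimplexCategory) :
    degenerateSieve X m = ⨆ e : { e : m ⟶ m // e ≫ e = e ∧ e ≠ 𝟙 m }, fixedSieve X e.1 := by
  ext T t
  rw [sieve_iSup_apply_iff]
  constructor
  · rintro ⟨k, hk, s, t', rfl⟩
    obtain ⟨k', ε, δ, γ, rfl, hγ, -, hk', -⟩ := exists_splitEpi_mono s
    -- The idempotent of the split epimorphism `ε`; were it the identity, `ε` would be monic and
    -- could not lower the dimension.
    refine ⟨⟨ε ≫ γ, ?_, fun h => ?_⟩, ?_⟩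
    · rw [Category.assoc, ← Category.assoc γ, hγ, Category.id_comp]
    · have : Mono ε := mono_of_mono_fac h
      have := SimplexCategory.len_le_of_mono ε
      lia
    · change (t' ≫ X.map (ε ≫ δ).op) ≫ X.map (ε ≫ γ).op = _
      rw [Category.assoc, ← X.map_comp, ← op_comp, Category.assoc, ← Category.assoc γ, hγ,
        Category.id_comp]
  · rintro ⟨⟨e, he, hne⟩, ht⟩
    obtain ⟨k, ε, δ, γ, hεδ, hγ, -, -, hk⟩ := exists_splitEpi_mono e
    refine ⟨k, hk fun h => hne ?_, ε, t ≫ X.map δ.op, ?_⟩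
    · rw [← cancel_epi e, he, Category.comp_id]
    · rw [Category.assoc, ← X.map_comp, ← op_comp, hεδ]
      exact ht

variable [CountablyLextensive E]

lemma cofibrant_of_decides_fixedSieve {X : SimplicialObject E}
    (h : ∀ ⦃n : SimplexCategory⦄ (e : n ⟶ n), e ≫ e = e → Decides (fixedSieve X e)) :
    Cofibrant X := by
  refine cofibrant_of_decides fun m => ?_
  rw [degenerateSieve_eq]
  exact Decides.iSup fun e => h e.1 e.2.1

/-- Splitting `e` as `ε ≫ δ`, the fixed simplices are those in the image of the degeneracy `X.map
ε.op`, which is a coproduct inclusion. -/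
lemma Cofibrant.decides_fixedSieve {X : SimplicialObject E} (hX : Cofibrant X)
    {n : SimplexCategory} (e : n ⟶ n) (he : e ≫ e = e) : Decides (fixedSieve X e) := by
  obtain ⟨k, ε, δ, γ, rfl, hγ, hδ, -, -⟩ := exists_splitEpi_mono e
  have hδε : δ ≫ ε = 𝟙 k := by
    have := congrArg (γ ≫ ·) he
    simp only [Category.assoc] at this
    rw [← Category.assoc γ, ← Category.assoc γ, hγ, Category.id_comp, Category.id_comp,
      ← Category.assoc] at this
    rw [← cancel_mono δ, this, Category.id_comp]
  obtain ⟨C, c, ⟨hc⟩⟩ := hX.exists_complement ε.op δ.op (by rw [← op_comp, hδε, op_id])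
  convert decides_factorSieve hc using 1
  ext T t
  constructor
  · intro ht
    refine ⟨t ≫ X.map δ.op, ?_⟩
    rw [Category.assoc, ← X.map_comp, ← op_comp]
    exact ht
  · rintro ⟨t', rfl⟩
    change (t' ≫ X.map ε.op) ≫ X.map (ε ≫ δ).op = _
    rw [Category.assoc, ← X.map_comp, ← op_comp, Category.assoc, hδε, Category.comp_id]

lemma decides_fixedSieve_of_iso {X Y : SimplicialObject E} (φ : Y ≅ X) {n : SimplexCategory}
    (e : n ⟶ n) (h : Decides (fixedSieve X e)) : Decides (fixedSieve Y e) := by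
  convert h.pullback (φ.hom.app (op n)) using 1
  ext T t
  change t ≫ Y.map e.op = t ↔ (t ≫ φ.hom.app (op n)) ≫ X.map e.op = t ≫ φ.hom.app (op n)
  rw [Category.assoc, ← φ.hom.naturality, ← Category.assoc, cancel_mono]

end Fixed

/-! ### Cofibrancy of the pushforward. -/

section Pushforward

variable {E : Type u} [Category.{v} E] {A B X : SimplicialObject E} {i : A ⟶ B} {q : X ⟶ A}

/-- A criterion for a family to be fixed by an idempotent. -/
lemma PushFamily.face_eq_self_iff (hi : ∀ m, Mono (i.app m)) {n : SimplexCategory} {T : E}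
    (F : PushFamily i q n T) (e : n ⟶ n) (he : e ≫ e = e) :
    F.face e = F ↔ F.base ≫ B.map e.op = F.base ∧
      ∀ (δ : LowFace n) (e' : ⦋δ.1⦌ ⟶ ⦋δ.1⦌), e' ≫ e' = e' → e' ≫ δ.2 = δ.2 ≫ e →
        ∀ ⦃T' : E⦄ (u : T' ⟶ T) (a) (h), F.val u δ.2 a h ≫ X.map e'.op = F.val u δ.2 a h := by
  have hA : ∀ ⦃m k : SimplexCategory⦄ (σ : m ⟶ n) (τ : k ⟶ n) (ρ : k ⟶ m),
      F.base ≫ B.map (ρ ≫ σ).op = F.base ≫ B.map τ.op → ∀ ⦃T' : E⦄ (u : T' ⟶ T) (a),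
      a ≫ i.app (op m) = u ≫ F.base ≫ B.map σ.op →
      (a ≫ A.map ρ.op) ≫ i.app (op k) = u ≫ F.base ≫ B.map τ.op := by
    intro m k σ τ ρ h T' u a ha
    rw [← h, Category.assoc, i.naturality, ← Category.assoc, ha, op_comp, B.map_comp]
    simp only [Category.assoc]
  have hbe : F.base ≫ B.map e.op = F.base → ∀ ⦃m : SimplexCategory⦄ (σ : m ⟶ n),
      F.base ≫ B.map (σ ≫ e).op = F.base ≫ B.map σ.op := fun hb m σ => by
    rw [op_comp, B.map_comp, ← Category.assoc, hb]
  constructor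
  · intro hF
    have hb : F.base ≫ B.map e.op = F.base := congrArg PushFamily.base hF
    refine ⟨hb, ?_⟩
    rintro δ e' - hδ T' u a h
    have h₁ := hA δ.2 δ.2 e' (by rw [hδ, hbe hb]) u a h
    have ha : a ≫ A.map e'.op = a := by
      have := hi (op ⦋δ.1⦌)
      rw [← cancel_mono (i.app (op ⦋δ.1⦌)), h₁, h]
    have h₂ := hA δ.2 (e' ≫ δ.2) e' rfl u a h
    have h₃ : (a ≫ A.map e'.op) ≫ i.app (op ⦋δ.1⦌) = u ≫ F.base ≫ B.map (δ.2 ≫ e).op := by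
      rw [h₂, hδ]
    refine (F.val_comp_right u e' δ.2 a h h₂).symm.trans ?_
    refine (F.val_congr rfl hδ rfl h₂ h₃).trans ?_
    refine (PushFamily.val_eq_of_eq hF u δ.2 _ (by simpa [PushFamily.face] using h₃) h₁).trans ?_
    exact F.val_congr rfl rfl ha _ _
  · rintro ⟨hb, hF⟩
    refine PushFamily.ext_val hb fun T' u m σ a h h' => ?_
    obtain ⟨k, δ, e', σ', κ, hk, he', hδ, rfl, hκ⟩ := exists_stable_face e he σ
    -- Since the base is fixed by `e`, its faces along `κ ≫ σ` and `δ` agree. So if the face `σ`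
    -- lies in `A`, the larger stable face `δ` does too, and the hypothesis applies to it.
    have h₁ := hA (σ' ≫ δ) δ κ (by rw [← hbe hb, Category.assoc, hκ, hbe hb]) u a h'
    have hx := hF ⟨⟨k.len, Nat.lt_succ_of_le hk⟩, δ⟩ e' he' hδ u (a ≫ A.map κ.op) h₁
    have h₂ := hA δ (σ' ≫ δ) σ' rfl u _ h₁
    have ha₁ : (a ≫ A.map κ.op) ≫ A.map σ'.op = a := by
      have := hi (op m)
      rw [← cancel_mono (i.app (op m)), h₂, h']
    have h₃ := hA δ (e' ≫ δ) e' rfl u _ h₁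
    have h₄ := hA (e' ≫ δ) (σ' ≫ e' ≫ δ) σ' rfl u _ h₃
    have ha₂ : ((a ≫ A.map κ.op) ≫ A.map e'.op) ≫ A.map σ'.op = a := by
      have := hi (op m)
      rw [← cancel_mono (i.app (op m)), h₄, h', hδ, ← Category.assoc σ', hbe hb]
    have h₅ : F.val u (e' ≫ δ) ((a ≫ A.map κ.op) ≫ A.map e'.op) h₃ =
        F.val u δ (a ≫ A.map κ.op) h₁ := (F.val_comp_right u e' δ _ h₁ h₃).trans hx
    have h₆ := F.val_comp_right u σ' (e' ≫ δ) _ h₃ h₄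
    rw [h₅, ← F.val_comp_right u σ' δ _ h₁ h₂] at h₆
    refine (F.val_congr rfl ?_ ha₂.symm _ h₄).trans (h₆.trans (F.val_congr rfl rfl ha₁ _ _))
    rw [hδ, Category.assoc]

variable [CountablyLextensive E]

/-- By `PushFamily.face_eq_self_iff`, being fixed by `e` is one condition on the base and finitely
many on values at stable low faces. Each of the latter is decided in two stages: whether the face
lies in `A`, and if so whether its value in `X` is fixed. -/
lemma decides_fixedSieve_of_representing
    (hi : ∀ m, ∃ (C : E) (c : C ⟶ B.obj m), Nonempty (IsColimit (BinaryCofan.mk (i.app m) c)))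
    (hB : Cofibrant B) (hX : Cofibrant X)
    {P : SimplicialObject E} {ξ : ∀ n, PushFamily i q n (P.obj (op n))}
    (hξ : ∀ ⦃n' n : SimplexCategory⦄ (θ : n' ⟶ n), (ξ n').restrict (P.map θ.op) = (ξ n).face θ)
    (hP : ∀ (n : SimplexCategory) ⦃T : E⦄ (F : PushFamily i q n T), ∃! t, (ξ n).restrict t = F)
    {n : SimplexCategory} (e : n ⟶ n) (he : e ≫ e = e) : Decides (fixedSieve P e) := by
  have hmono : ∀ m, Mono (i.app m) := fun m => by
    obtain ⟨C, c, ⟨hc⟩⟩ := hi m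
    exact FinitaryExtensive.mono_inl_of_isColimit hc
  let J : Type := { p : Σ δ : LowFace n, (⦋δ.1⦌ ⟶ ⦋δ.1⦌) // p.2 ≫ p.2 = p.2 ∧ p.2 ≫ p.1.2 = p.1.2 ≫ e }
  let K : J → Sieve (P.obj (op n)) := fun j =>
    { arrows := fun T t => ∀ ⦃T' : E⦄ (u : T' ⟶ T) (a) (h), (ξ n).val (u ≫ t) j.1.1.2 a h ≫
        X.map j.1.2.op = (ξ n).val (u ≫ t) j.1.1.2 a h
      downward_closed := fun {T T'} t ht u T'' u' a h => by
        have h' := h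
        rw [← Category.assoc u'] at h'
        have e₁ := (ξ n).val_congr (Category.assoc u' u t).symm rfl rfl h h'
        rw [e₁]
        exact ht (u' ≫ u) a h' }
  have hK : ∀ j, Decides (K j) := by
    intro j
    obtain ⟨C, c, ⟨hc⟩⟩ := hi (op ⦋j.1.1.1⦌)
    refine Decides.of_cover
      ((decides_factorSieve hc).pullback ((ξ n).base ≫ B.map j.1.1.2.op)) ?_
    rintro T t (⟨a, ha⟩ | ht)
    · convert (hX.decides_fixedSieve j.1.2 j.2.1).pullback ((ξ n).val t j.1.1.2 a ha) using 1
      ext T' u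
      have hr : ∀ ⦃T'' : E⦄ (u' : T'' ⟶ T') (a') (h), (ξ n).val (u' ≫ u ≫ t) j.1.1.2 a' h =
          u' ≫ u ≫ (ξ n).val t j.1.1.2 a ha := by
        intro T'' u' a' h
        have := hmono (op ⦋j.1.1.1⦌)
        obtain rfl : a' = (u' ≫ u) ≫ a := by
          rw [← cancel_mono (i.app (op ⦋j.1.1.1⦌)), h, Category.assoc _ a, ha]
          simp only [Category.assoc]
        have h' := h
        rw [← Category.assoc u'] at h'
        exact ((ξ n).val_congr (Category.assoc _ _ _).symm rfl rfl _ h').trans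
          (((ξ n).val_comp_left (u' ≫ u) t j.1.1.2 a ha h').trans (Category.assoc _ _ _))
      change (∀ ⦃T'' : E⦄ (u' : T'' ⟶ T') (a') (h), (ξ n).val (u' ≫ u ≫ t) j.1.1.2 a' h ≫
        X.map j.1.2.op = (ξ n).val (u' ≫ u ≫ t) j.1.1.2 a' h) ↔
        (u ≫ (ξ n).val t j.1.1.2 a ha) ≫ X.map j.1.2.op = u ≫ (ξ n).val t j.1.1.2 a ha
      constructor
      · intro h
        have h₁ : (u ≫ a) ≫ i.app _ = (𝟙 _ ≫ u ≫ t) ≫ (ξ n).base ≫ B.map j.1.1.2.op := by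
          rw [Category.assoc, ha, Category.id_comp, Category.assoc]
        have := h (𝟙 _) (u ≫ a) h₁
        rwa [hr, Category.id_comp] at this
      · intro h T'' u' a' h'
        rw [hr, Category.assoc, h]
    -- Where the face avoids `A` there is no value to test, and the condition holds vacuously.
    · refine decides_of_forall fun T' u a h => hom_ext_of_bot (ht u ⟨a, ?_⟩) _ _
      rw [h]
      simp
  have heq : fixedSieve P e = (fixedSieve B e).pullback (ξ n).base ⊓ ⨅ j, K j := by
    ext T t
    have h₁ : fixedSieve P e t ↔ ((ξ n).restrict t).face e = (ξ n).restrict t := by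
      rw [PushFamily.restrict_face, ← hξ, PushFamily.restrict_restrict]
      exact ⟨fun h => congrArg _ h, fun h => (hP n _).unique h rfl⟩
    rw [h₁, PushFamily.face_eq_self_iff hmono _ e he]
    refine and_congr Iff.rfl ?_
    rw [sieve_iInf_apply_iff]
    exact ⟨fun h j T' u a ha => h j.1.1 j.1.2 j.2.1 j.2.2 u a
        (by simpa [PushFamily.restrict] using ha),
      fun h δ e' he' hδ T' u a ha => h ⟨⟨δ, e'⟩, he', hδ⟩ u a
        (by simpa [PushFamily.restrict] using ha)⟩
  rw [heq]
  exact ((hB.decides_fixedSieve e he).pullback _).inf_of fun _ t _ => (Decides.iInf hK).pullback t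

end Pushforward

end EnrichedLifting

theorem mainTheorem11 {E : Type u} [Category.{v} E] [CountablyLextensive E]
    {A B : SimplicialObject E} (i : A ⟶ B) (hA : EnrichedLifting.Cofibrant A)
    (hB : EnrichedLifting.Cofibrant B) (hi : EnrichedLifting.Cofibration i) :
    EnrichedLifting.Exponentiable i ∧
      ∀ (pushforward : Over A ⥤ Over B), (Over.pullback i ⊣ pushforward) →
        ∀ X : Over A, EnrichedLifting.Cofibrant X.left →
          EnrichedLifting.Cofibrant (pushforward.obj X).left := by
  refine ⟨?_, fun pushforward adj X hX => ?_⟩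
  · rw [EnrichedLifting.Exponentiable, isLeftAdjoint_iff_hasTerminal_costructuredArrow]
    intro X
    obtain ⟨P, ξ, hξ, hP⟩ := EnrichedLifting.exists_representing_simplicialObject
      hi.exists_complement X.hom
    obtain ⟨ϖ, ε, ⟨h⟩⟩ := EnrichedLifting.exists_isTerminal_of_representing hξ hP
    exact h.hasTerminal
  · obtain ⟨P, ξ, hξ, hP⟩ := EnrichedLifting.exists_representing_simplicialObject
      hi.exists_complement X.hom
    obtain ⟨ϖ, ε, ⟨h⟩⟩ := EnrichedLifting.exists_isTerminal_of_representing hξ hP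
    -- An arbitrary right adjoint agrees with the explicit construction, both being terminal in the
    -- same comma category.
    have φ : (pushforward.obj X).left ≅ P := (Over.forget B).mapIso
      ((CostructuredArrow.proj _ _).mapIso ((mkTerminalOfRightAdjoint _ adj X).uniqueUpToIso h))
    exact EnrichedLifting.cofibrant_of_decides_fixedSieve fun n e he =>
      EnrichedLifting.decides_fixedSieve_of_iso φ e
        (EnrichedLifting.decides_fixedSieve_of_representing hi.exists_complement hB hX hξ hP e he)
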